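/- **Advantage of FA-CAR over FA-MR.** *Model.* For each $p$ let $X=X_p\in\mathbb R^{n\times p}$ (with $n=n_p$), $\beta=\beta_p\in\mathbb R^p$ with support $S=S_p$, $s_p=|S|$, and $y=X\beta+z$ with $z\sim N(0,\sigma^2I_n)$, where $\sigma=\sigma_p>0$. The Gram matrix $\Theta=\frac1nX'X$ has unit diagonal and $\Theta=\sum_{k=1}^K\lambda_kv_kv_k'+G_0$, where $K=K_p$ satisfies $K/\min\{n,p\}\to0$, $\lambda_k>0$, and the $v_k$ are orthonormal (no factors, $K=0$, is allowed). Fix $\vartheta,\gamma\in(0,1)$, constants $r,c_0,C_0,c_1,a,b,C>0$ and integers $1\le\ell_0\le g$. Let $\tau_p=n^{-1/2}\sigma\sqrt{2r\log p}$ and $\delta_p=b/\log p$. For a symmetric matrix $M$ and $t>0$, the graph of $M$ at level $t$ has nodes $\{1,\dots,p\}$ and an edge between $i\ne j$ iff $|M(i,j)|/\sqrt{M(i,i)M(j,j)}>t$. Assume, for all sufficiently large $p$: 1. $\log(p)/n\to0$, $s_p\le p^{1-\vartheta}$, and $\tau_p\le|\beta_j|\le a\tau_p$ for all $j\in S$;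 2. $G_0$ is positive semidefinite, every $g\times g$ principal submatrix of $G_0$ has smallest eigenvalue at least $c_0$, and $\max_i\sum_j|G_0(i,j)|^\gamma\le C_0$; 3. $\max_k\lambda_k\le c_1\min_k\lambda_k$ and $\min_k\lambda_k/\max\{s_p,\log p\}\to\infty$; 4. in the graph of $G_0$ at level $\delta_p$, each component of the subgraph induced on $S$ has at most $\ell_0$ nodes. *Factor adjusting.* Let $X=\sum_{k}\hat\sigma_k\hat u_k\hat v_k'$ be a singular value decomposition with $\hat\sigma_1\ge\hat\sigma_2\ge\cdots\ge0$, and let $\hat K$ be the largest $k\ge1$ with $\hat\sigma_k^2>n\log p$ ($\hat K=0$ if there is none). Put $\tilde y=y-\sum_{k\le\hat K}(\hat u_k'y)\hat u_k$ and $\tilde X=X-\sum_{k\le\hat K}\hat\sigma_k\hat u_k\hat v_k'=[\tilde x_1,\dots,\tilde x_p]$. *FA-CAR.* Let $m=m_p$ be an integer and $\delta$ a number with $\ell_0\le m\le g$ and $1.01\,\delta_p\le\delta\le C\delta_p$ for large $p$. Let $\mathcal A_{\delta,j}(m)$ be the family of sets $I\ni j$ with $|I|\le m$ that induce a connected subgraph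 of the graph of $\frac1n\tilde X'\tilde X$ at level $\delta$. With $P_I$ the orthogonal projection onto $\mathrm{span}\{\tilde x_k:k\in I\}$, the score of variable $j$ is $$T_j^*=\max\{\|P_I\tilde y\|^2-\|P_{I\setminus\{j\}}\tilde y\|^2: I\in\mathcal A_{\delta,j}(m)\}.$$ *FA-MR.* Normalize $\tilde x_j^*=(\sqrt n/\|\tilde x_j\|)\tilde x_j$ (with $\tilde x_j^*=0$ if $\tilde x_j=0$) and rank by the marginal coefficients $M_j=|(\tilde x_j^*,\tilde y)|/(\tilde x_j^*,\tilde x_j^*)$ (read as $0$ if $\tilde x_j^*=0$); the score of variable $j$ is $nM_j^2$. *Sure-screening model size.* For a method with scores $T_1,\dots,T_p$ and a constant $q>0$ let $\hat S_p(q)=\{j:T_j>2q\sigma^2\log p\}$. The sure-screening model size of the method at $p$ is $$s_p+\inf\Bigl\{\mathbb E|\hat S_p(q)\setminus S_p|:\ q>0\ \text{a constant with}\ \lim_{p'\to\infty}\mathbb E|S_{p'}\setminus\hat S_{p'}(q)|=0\Bigr\}\in[0,\infty],$$ with $\inf\emptyset=\infty$. Write $SS_p^*$ for FA-CAR and $\widetilde{SS}{}_p^*$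 for FA-MR. *Claim.* There is a positive sequence $L_p$ with $L_pp^{c}\to\infty$ and $L_pp^{-c}\to0$ for every $c>0$ (a multi-$\log(p)$ term) such that, for all sufficiently large $p$, $$SS_p^*\ \le\ L_p\cdot\widetilde{SS}{}_p^*.$$ -/

import Mathlib

open Filter Topology MeasureTheory ProbabilityTheory
open scoped ENNReal

noncomputable section

namespace FACAR

/-! ### Linear model with an approximate factor design -/

/-- The `j`-th column of `X`, as a vector of the Euclidean space `ℝⁿ`. -/
def col {n p : ℕ} (X : Matrix (Fin n) (Fin p) ℝ) (j : Fin p) : EuclideanSpace ℝ (Fin n) :=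
  WithLp.toLp 2 (fun i => X i j)

/-- The Gram matrix `(1/n) X' X`. -/
def gram {n p : ℕ} (X : Matrix (Fin n) (Fin p) ℝ) : Matrix (Fin p) (Fin p) ℝ :=
  (1 / (n : ℝ)) • (X.transpose * X)

/-- The support `S` of `β`. -/
def supp {p : ℕ} (β : Fin p → ℝ) : Finset (Fin p) :=
  Finset.univ.filter (fun j => β j ≠ 0)

/-- The response `y = X β + z`. -/
def response {n p : ℕ} (X : Matrix (Fin n) (Fin p) ℝ) (β : Fin p → ℝ)
    (z : EuclideanSpace ℝ (Fin n)) : EuclideanSpace ℝ (Fin n) :=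
  WithLp.toLp 2 (X.mulVec β) + z

/-- The law `N(0, σ² Iₙ)` of the noise. -/
def noiseLaw (n : ℕ) (σ : ℝ) : Measure (EuclideanSpace ℝ (Fin n)) :=
  multivariateGaussian 0 (σ ^ 2 • (1 : Matrix (Fin n) (Fin n) ℝ))

/-- The class `M_p(g, γ, c₀, C₀)`: positive semidefinite matrices, all of whose `g × g` principal
submatrices have all eigenvalues at least `c₀`, and all of whose rows have `∑ⱼ |Ω(i,j)|^γ ≤ C₀`. -/
def SparseCov {p : ℕ} (g : ℕ) (γ c₀ C₀ : ℝ) (Ω : Matrix (Fin p) (Fin p) ℝ) : Prop :=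
  Ω.PosSemidef ∧
  (∀ I : Finset (Fin p), I.card = g → ∀ μ : ℝ,
    Module.End.HasEigenvalue
      (Matrix.toLin' (Ω.submatrix (Subtype.val : I → Fin p) (Subtype.val : I → Fin p))) μ →
    c₀ ≤ μ) ∧
  (∀ i, ∑ j, |Ω i j| ^ γ ≤ C₀)

/-- The graph on `{1, …, p}` with an edge between distinct `i`, `j` if and only if
`|G(i,j)| / √(G(i,i) G(j,j)) > δ` (for a symmetric matrix `G`). -/
def corrGraph {p : ℕ} (G : Matrix (Fin p) (Fin p) ℝ) (δ : ℝ) : SimpleGraph (Fin p) :=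
  SimpleGraph.fromRel (fun i j => δ < |G i j| / √(G i i * G j j))

/-- Each component of the subgraph of `𝒢` induced on `S` has at most `ℓ₀` nodes. -/
def ComponentsAtMost {p : ℕ} (𝒢 : SimpleGraph (Fin p)) (S : Finset (Fin p)) (ℓ₀ : ℕ) : Prop :=
  ∀ c : (𝒢.induce (S : Set (Fin p))).ConnectedComponent, c.supp.ncard ≤ ℓ₀

/-- The signal strength `τ_p = n^{-1/2} σ √(2 r log p)`. -/
def signalStrength (n p : ℕ) (σ r : ℝ) : ℝ :=
  (√(n : ℝ))⁻¹ * σ * √(2 * r * Real.log p)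

/-! ### Factor adjusting -/

/-- A singular value decomposition `X = ∑ₖ σₖ uₖ vₖ'` with `σ₁ ≥ σ₂ ≥ ⋯ ≥ 0`. -/
structure SVD {n p : ℕ} (X : Matrix (Fin n) (Fin p) ℝ) where
  sing : Fin (min n p) → ℝ
  left : Fin (min n p) → EuclideanSpace ℝ (Fin n)
  right : Fin (min n p) → EuclideanSpace ℝ (Fin p)
  sing_nonneg : ∀ k, 0 ≤ sing k
  sing_antitone : Antitone sing
  left_orthonormal : Orthonormal ℝ left
  right_orthonormal : Orthonormal ℝ right
  eq_sum : ∀ i j, X i j = ∑ k, sing k * left k i * right k j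

/-- The number of factors to remove: the largest `k ≥ 1` with `σₖ² > n log p`, and `0` if there is
none. (The element `k` of `Fin (min n p)` stands for the one-based index `k + 1`.) -/
def SVD.numFactors {n p : ℕ} {X : Matrix (Fin n) (Fin p) ℝ} (D : SVD X) : ℕ :=
  (Finset.univ.filter (fun k => (n : ℝ) * Real.log p < D.sing k ^ 2)).sup (fun k => (k : ℕ) + 1)

/-- `ỹ = y - ∑_{k ≤ K} (uₖ' y) uₖ`. -/
def SVD.adjVec {n p : ℕ} {X : Matrix (Fin n) (Fin p) ℝ} (D : SVD X) (K : ℕ)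
    (y : EuclideanSpace ℝ (Fin n)) : EuclideanSpace ℝ (Fin n) :=
  y - ∑ k ∈ Finset.univ.filter (fun k : Fin (min n p) => (k : ℕ) < K),
    inner ℝ (D.left k) y • D.left k

/-- `X̃ = X - ∑_{k ≤ K} σₖ uₖ vₖ'`. -/
def SVD.adjMat {n p : ℕ} {X : Matrix (Fin n) (Fin p) ℝ} (D : SVD X) (K : ℕ) :
    Matrix (Fin n) (Fin p) ℝ :=
  Matrix.of fun i j => X i j - ∑ k ∈ Finset.univ.filter (fun k : Fin (min n p) => (k : ℕ) < K),
    D.sing k * D.left k i * D.right k j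

/-! ### Covariate-assisted ranking and marginal ranking -/

/-- The neighborhoods `𝒜_{δ,j}(m)`: the node sets `I` with `j ∈ I`, `|I| ≤ m` that are connected
in the graph. -/
def neighborhoods {p : ℕ} (𝒢 : SimpleGraph (Fin p)) (m : ℕ) (j : Fin p) : Set (Finset (Fin p)) :=
  {I | j ∈ I ∧ I.card ≤ m ∧ (𝒢.induce (I : Set (Fin p))).Connected}

/-- `P_I y`, the orthogonal projection of `y` onto the span of the columns of `X` in `I`. -/
def proj {n p : ℕ} (X : Matrix (Fin n) (Fin p) ℝ) (I : Finset (Fin p))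
    (y : EuclideanSpace ℝ (Fin n)) : EuclideanSpace ℝ (Fin n) :=
  (Submodule.span ℝ (col X '' (I : Set (Fin p)))).starProjection y

/-- `T_{j|I} = ‖P_I y‖² - ‖P_{I ∖ {j}} y‖²`. -/
def localScore {n p : ℕ} (X : Matrix (Fin n) (Fin p) ℝ) (y : EuclideanSpace ℝ (Fin n))
    (j : Fin p) (I : Finset (Fin p)) : ℝ :=
  ‖proj X I y‖ ^ 2 - ‖proj X (I.erase j) y‖ ^ 2

/-- `T_j^* = max {T_{j|I} : I ∈ 𝒜_{δ,j}(m)}`; the set is finite, and for `m ≥ 1` it contains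
`T_{j|{j}}`, so the supremum is a maximum. -/
def carScore {n p : ℕ} (X : Matrix (Fin n) (Fin p) ℝ) (m : ℕ) (δ : ℝ)
    (y : EuclideanSpace ℝ (Fin n)) (j : Fin p) : ℝ :=
  sSup (localScore X y j '' neighborhoods (corrGraph (gram X) δ) m j)

/-- The scores of FA-CAR: the `T_j^*` computed from `X̃` and `ỹ`, with the number of removed
factors chosen by `numFactors`. -/
def faCarScore {n p : ℕ} {X : Matrix (Fin n) (Fin p) ℝ} (D : SVD X) (m : ℕ) (δ : ℝ)
    (y : EuclideanSpace ℝ (Fin n)) (j : Fin p) : ℝ :=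
  carScore (D.adjMat D.numFactors) m δ (D.adjVec D.numFactors y) j

/-- The marginal regression coefficient `|(x, y)| / (x, x)`. -/
def marginalCoef {n : ℕ} (x y : EuclideanSpace ℝ (Fin n)) : ℝ :=
  |inner ℝ x y| / inner ℝ x x

/-- The scores of FA-MR: the columns of `X̃` are first normalized to the norm `√n`, giving
`x*_j = (√n / ‖x̃_j‖) x̃_j`; the variables are then ranked by the marginal coefficients
`|(x*_j, ỹ)| / (x*_j, x*_j)`. The increasing transformation `t ↦ n t²` puts these on the scale of
the thresholds `2 q σ² log p`. -/
def faMrScore {n p : ℕ} {X : Matrix (Fin n) (Fin p) ℝ} (D : SVD X)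
    (y : EuclideanSpace ℝ (Fin n)) (j : Fin p) : ℝ :=
  (n : ℝ) * marginalCoef
    ((√(n : ℝ) / ‖col (D.adjMat D.numFactors) j‖) • col (D.adjMat D.numFactors) j)
    (D.adjVec D.numFactors y) ^ 2

/-! ### Sure-screening model size -/

/-- `Ŝ(q)`: the variables whose score exceeds `t_p(q) = 2 q σ² log p`. -/
def retained {p : ℕ} (σ q : ℝ) (T : Fin p → ℝ) : Finset (Fin p) :=
  {j | 2 * q * σ ^ 2 * Real.log p < T j}

/-- `E |S ∖ Ŝ(q)|`, for the scores `T` (a function of the response). -/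
def expMissed {n p : ℕ} (X : Matrix (Fin n) (Fin p) ℝ) (β : Fin p → ℝ) (σ : ℝ)
    (T : EuclideanSpace ℝ (Fin n) → Fin p → ℝ) (q : ℝ) : ℝ≥0∞ :=
  ∫⁻ z, ((supp β \ retained σ q (T (response X β z))).card : ℝ≥0∞) ∂(noiseLaw n σ)

/-- `E |Ŝ(q) ∖ S|`, for the scores `T` (a function of the response). -/
def expFalse {n p : ℕ} (X : Matrix (Fin n) (Fin p) ℝ) (β : Fin p → ℝ) (σ : ℝ)
    (T : EuclideanSpace ℝ (Fin n) → Fin p → ℝ) (q : ℝ) : ℝ≥0∞ :=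
  ∫⁻ z, ((retained σ q (T (response X β z)) \ supp β).card : ℝ≥0∞) ∂(noiseLaw n σ)

/-- The (asymptotic) sure-screening model size: `s_p` plus the infimum of `E |Ŝ_p(q) ∖ S|` over the
constants `q > 0` for which `E |S ∖ Ŝ_p(q)| → 0` as `p → ∞`. It is `∞` if there is no such `q`. -/
def sureScreeningSize {n : ℕ → ℕ} (X : ∀ p, Matrix (Fin (n p)) (Fin p) ℝ)
    (β : ∀ p, Fin p → ℝ) (σ : ℕ → ℝ)
    (T : ∀ p, EuclideanSpace ℝ (Fin (n p)) → Fin p → ℝ) (p : ℕ) : ℝ≥0∞ :=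
  ((supp (β p)).card : ℝ≥0∞) +
    ⨅ q ∈ {q : ℝ | 0 < q ∧
      Tendsto (fun p' => expMissed (X p') (β p') (σ p') (T p') q) atTop (𝓝 0)},
      expFalse (X p) (β p) (σ p) (T p) q

/-- Multi-`log(p)` terms: positive sequences with `L_p p^c → ∞` and `L_p p^{-c} → 0` for every
`c > 0`. -/
def IsMultiLog (L : ℕ → ℝ) : Prop :=
  (∀ p, 0 < L p) ∧ ∀ c : ℝ, 0 < c →
    Tendsto (fun p : ℕ => L p * (p : ℝ) ^ c) atTop atTop ∧
    Tendsto (fun p : ℕ => L p * (p : ℝ) ^ (-c)) atTop (𝓝 0)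

end FACAR

end

noncomputable section

namespace FACAR

/-! ### Gaussian tails -/

/-! The marginal score of `j` is the local score of the singleton `{j}`, and singletons are always
among the neighborhoods. So FA-CAR scores dominate FA-MR scores, FA-CAR misses no more signals, and
every threshold `q` admissible for FA-MR is admissible for FA-CAR. It remains to compare false
positives at the same `q`.

Each local score is the square of `⟨e, ỹ⟩`, with `e` a unit vector (or zero) in the span of a few
adjusted columns, and its noise part is exactly `N(0, σ²)`. With `x = √(2q log p)`, the marginal
score exceeds the threshold with probability at least about `exp(-x²/2)`, up to a factor `1 + x`,
whatever its mean. A local score exceeds it with probability at most `2 exp(-x²/2 + ρx)` when its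
mean is at most `σρ` (`noiseLaw_lt_faCarScore_le`).

The adjusted Gram matrix is entrywise within `O(1/Λ)` of `G₀`, where `Λ` bounds the factors from
below (`abs_gram_adjMat_sub_le`). Hence its graph has degrees `O(log p)`, and every node has
polylogarithmically many neighborhoods. Nodes near the support number at most `s_p` times a
polylogarithm and are charged to the term `s_p`. At the other nodes `ρ = o(√log p)`, so for bounded
`q` the ratio of the probabilities is `p^{o(1)}` (`expFalse_faCarScore_le`). If the admissible `q`
are unbounded, the FA-CAR infimum is zero. This gives a factor `p^κ` for each `κ > 0`, and a
diagonal choice `κ_p → 0` yields the multi-log factor. -/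

instance isProbabilityMeasure_noiseLaw (n : ℕ) (σ : ℝ) : IsProbabilityMeasure (noiseLaw n σ) := by
  unfold noiseLaw; infer_instance

lemma noiseLaw_map_inner {n : ℕ} (σ : ℝ) {e : EuclideanSpace ℝ (Fin n)} (he : ‖e‖ = 1) :
    (noiseLaw n σ).map (fun z => inner ℝ e z) = gaussianReal 0 (Real.toNNReal (σ ^ 2)) := by
  have hS : (σ ^ 2 • (1 : Matrix (Fin n) (Fin n) ℝ)).PosSemidef :=
    Matrix.PosSemidef.one.smul (sq_nonneg σ)
  have : IsProbabilityMeasure ((noiseLaw n σ).map (fun z => inner ℝ e z)) :=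
    Measure.isProbabilityMeasure_map (by fun_prop)
  apply Measure.ext_of_charFun
  ext t
  rw [charFun_apply_real, integral_map (by fun_prop) (by fun_prop), charFun_gaussianReal]
  have h2 := charFun_multivariateGaussian (μ := 0) hS (t • e)
  rw [charFun_apply] at h2
  have h3 : (∫ z, Complex.exp (t * (inner ℝ e z : ℝ) * Complex.I) ∂(noiseLaw n σ))
      = ∫ x, Complex.exp ((inner ℝ x (t • e) : ℝ) * Complex.I)
        ∂(multivariateGaussian 0 (σ ^ 2 • (1 : Matrix (Fin n) (Fin n) ℝ))) := by
    apply integral_congr_ae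
    filter_upwards with z
    rw [inner_smul_right, real_inner_comm]
    push_cast
    rfl
  rw [h3, h2]
  have h4 : (t • e).ofLp ⬝ᵥ (σ ^ 2 • (1 : Matrix (Fin n) (Fin n) ℝ)).mulVec (t • e).ofLp
      = σ ^ 2 * t ^ 2 := by
    have : e.ofLp ⬝ᵥ e.ofLp = 1 := by
      have := EuclideanSpace.real_norm_sq_eq e
      rw [he] at this
      simp only [dotProduct, ← sq]
      linarith
    simp only [WithLp.ofLp_smul, Matrix.smul_mulVec, Matrix.one_mulVec, dotProduct_smul,
      smul_dotProduct, this, smul_eq_mul]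
    ring
  rw [h4]
  congr 1
  simp [Real.coe_toNNReal _ (sq_nonneg σ)]

lemma noiseLaw_map_inner_div {n : ℕ} {σ : ℝ} (hσ : 0 < σ) {e : EuclideanSpace ℝ (Fin n)}
    (he : ‖e‖ = 1) :
    (noiseLaw n σ).map (fun z => σ⁻¹ * inner ℝ e z) = gaussianReal 0 1 := by
  have h : (fun z => σ⁻¹ * inner ℝ e z) = (fun x => σ⁻¹ * x) ∘ (fun z => inner ℝ e z) := rfl
  rw [h, ← Measure.map_map (by fun_prop) (by fun_prop), noiseLaw_map_inner σ he,
    gaussianReal_map_const_mul]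
  congr 1
  · simp
  · ext
    simp [Real.coe_toNNReal _ (sq_nonneg σ)]
    field_simp

lemma gaussianReal_Ici_le {x : ℝ} (hx : 0 ≤ x) :
    gaussianReal 0 1 (Set.Ici x) ≤ ENNReal.ofReal (Real.exp (-(x ^ 2) / 2)) := by
  have h : HasSubgaussianMGF (fun x : ℝ => x) 1 (gaussianReal 0 1) := by
    refine ⟨fun t => integrable_exp_mul_gaussianReal t, fun t => ?_⟩
    have := congrFun (mgf_fun_id_gaussianReal (μ := 0) (v := 1)) t
    rw [this]
    simp
  have h1 := h.measure_ge_le hx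
  rw [measureReal_def] at h1
  have h2 := (ENNReal.le_ofReal_iff_toReal_le (measure_ne_top _ _) (Real.exp_pos _).le).2 h1
  change gaussianReal 0 1 {ω | x ≤ ω} ≤ _
  simpa using h2

/-- On an interval of length `h = 1/(1+x)` to the right of `x`, the square grows by at most `2xh +
h² ≤ 3`, so the density loses only a constant factor. The constant is `(1/3)(3/20) = 1/20`. Up to
the factor `1 + x` this matches the Chernoff upper bound. -/
lemma le_gaussianReal_Ioi {x : ℝ} (hx : 0 ≤ x) :
    ENNReal.ofReal (Real.exp (-(x ^ 2) / 2) / (20 * (1 + x))) ≤ gaussianReal 0 1 (Set.Ioi x) := by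
  set h : ℝ := 1 / (1 + x) with hh
  have hpos : 0 < 1 + x := by linarith
  have h0 : 0 < h := by positivity
  have hle : h ≤ 1 := by rw [hh, div_le_one hpos]; linarith
  have hxh : x * h ≤ 1 := by rw [hh, mul_one_div, div_le_one hpos]; linarith
  have hsub : Set.Ioc x (x + h) ⊆ Set.Ioi x := fun y hy => hy.1
  refine le_trans ?_ (measure_mono hsub)
  rw [gaussianReal_apply 0 one_ne_zero]
  have hc : ∀ y ∈ Set.Ioc x (x + h),
      ENNReal.ofReal (Real.exp (-(x ^ 2) / 2) / 20) ≤ gaussianPDF 0 1 y := by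
    intro y hy
    rw [gaussianPDF_def]
    apply ENNReal.ofReal_le_ofReal
    rw [gaussianPDFReal_def]
    have hy2 : y ^ 2 ≤ x ^ 2 + 3 := by
      have : y ^ 2 ≤ (x + h) ^ 2 := by
        apply pow_le_pow_left₀ (by linarith [hy.1]) hy.2
      nlinarith
    have e1 : Real.exp (-(x ^ 2) / 2) * Real.exp (-3 / 2) ≤
        Real.exp (-(y - 0) ^ 2 / (2 * ((1 : NNReal) : ℝ))) := by
      rw [← Real.exp_add]
      apply Real.exp_le_exp.2
      simp
      linarith
    have e2 : (1 : ℝ) / 3 ≤ (√(2 * Real.pi * ((1 : NNReal) : ℝ)))⁻¹ := by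
      rw [one_div]
      apply inv_anti₀
      · apply Real.sqrt_pos.2; simp [Real.pi_pos]
      · apply Real.sqrt_le_iff.2
        refine ⟨by norm_num, ?_⟩
        simp
        linarith [Real.pi_lt_four]
    have e3 : (3 : ℝ) / 20 ≤ Real.exp (-3 / 2) := by
      have : Real.exp (3 / 2 : ℝ) ≤ 20 / 3 := by
        have h1 : Real.exp (3 / 2 : ℝ) ^ 2 ≤ (20 / 3) ^ 2 := by
          rw [← Real.exp_nat_mul]
          have : ((2 : ℕ) : ℝ) * (3 / 2) = (3 : ℕ) * 1 := by norm_num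
          rw [this, Real.exp_nat_mul]
          calc Real.exp 1 ^ 3 ≤ 3 ^ 3 := by
                apply pow_le_pow_left₀ (Real.exp_pos _).le
                linarith [Real.exp_one_lt_d9]
            _ ≤ _ := by norm_num
        exact le_of_sq_le_sq h1 (by norm_num)
      rw [show (-3 / 2 : ℝ) = -(3 / 2) by norm_num, Real.exp_neg]
      rw [show (3 / 20 : ℝ) = (20 / 3)⁻¹ by norm_num]
      exact inv_anti₀ (Real.exp_pos _) this
    calc Real.exp (-(x ^ 2) / 2) / 20
        = (1 / 3) * (Real.exp (-(x ^ 2) / 2) * (3 / 20)) := by ring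
      _ ≤ (1 / 3) * (Real.exp (-(x ^ 2) / 2) * Real.exp (-3 / 2)) := by gcongr
      _ ≤ _ := mul_le_mul e2 e1 (by positivity) (by positivity)
  calc ENNReal.ofReal (Real.exp (-(x ^ 2) / 2) / (20 * (1 + x)))
      = ENNReal.ofReal (Real.exp (-(x ^ 2) / 2) / 20) * volume (Set.Ioc x (x + h)) := by
        rw [Real.volume_Ioc, ← ENNReal.ofReal_mul (by positivity), hh]
        congr 1
        field_simp
        ring
    _ = ∫⁻ _ in Set.Ioc x (x + h), ENNReal.ofReal (Real.exp (-(x ^ 2) / 2) / 20) := by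
        rw [setLIntegral_const]
    _ ≤ _ := setLIntegral_mono' measurableSet_Ioc hc

lemma noiseLaw_le_inner {n : ℕ} {σ : ℝ} (hσ : 0 < σ) {e : EuclideanSpace ℝ (Fin n)}
    (he : ‖e‖ = 1) {x : ℝ} (hx : 0 ≤ x) :
    noiseLaw n σ {z | σ * x ≤ inner ℝ e z} ≤ ENNReal.ofReal (Real.exp (-(x ^ 2) / 2)) := by
  have h : {z | σ * x ≤ inner ℝ e z} = (fun z => σ⁻¹ * inner ℝ e z) ⁻¹' Set.Ici x := by
    ext z
    simp [← div_eq_inv_mul, le_div_iff₀' hσ]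
  rw [h, ← Measure.map_apply (by fun_prop) measurableSet_Ici, noiseLaw_map_inner_div hσ he]
  exact gaussianReal_Ici_le hx

lemma noiseLaw_le_abs_inner {n : ℕ} {σ : ℝ} (hσ : 0 < σ) {e : EuclideanSpace ℝ (Fin n)}
    (he : ‖e‖ = 1) {x : ℝ} (hx : 0 ≤ x) :
    noiseLaw n σ {z | σ * x ≤ |inner ℝ e z|} ≤
      ENNReal.ofReal (2 * Real.exp (-(x ^ 2) / 2)) := by
  have h : {z | σ * x ≤ |inner ℝ e z|} ⊆
      {z | σ * x ≤ inner ℝ e z} ∪ {z | σ * x ≤ inner ℝ (-e) z} := by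
    intro z hz
    simp only [Set.mem_ofPred_eq, Set.mem_union, inner_neg_left] at hz ⊢
    exact le_abs.1 hz
  calc _ ≤ _ := measure_mono h
    _ ≤ _ := measure_union_le _ _
    _ ≤ _ := add_le_add (noiseLaw_le_inner hσ he hx)
        (noiseLaw_le_inner hσ (e := -e) (by rwa [norm_neg]) hx)
    _ = _ := by
      rw [← ENNReal.ofReal_add (Real.exp_pos _).le (Real.exp_pos _).le]
      congr 1; ring

lemma le_noiseLaw_lt_inner {n : ℕ} {σ : ℝ} (hσ : 0 < σ) {e : EuclideanSpace ℝ (Fin n)}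
    (he : ‖e‖ = 1) {x : ℝ} (hx : 0 ≤ x) :
    ENNReal.ofReal (Real.exp (-(x ^ 2) / 2) / (20 * (1 + x))) ≤
      noiseLaw n σ {z | σ * x < inner ℝ e z} := by
  have h : {z | σ * x < inner ℝ e z} = (fun z => σ⁻¹ * inner ℝ e z) ⁻¹' Set.Ioi x := by
    ext z
    simp [← div_eq_inv_mul, lt_div_iff₀' hσ]
  rw [h, ← Measure.map_apply (by fun_prop) measurableSet_Ioi, noiseLaw_map_inner_div hσ he]
  exact le_gaussianReal_Ioi hx

/-- A shifted one-dimensional noise exceeds a level at least as often as a one-sided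
centred noise does. -/
lemma le_noiseLaw_lt_add_inner_sq {n : ℕ} {σ : ℝ} (hσ : 0 < σ) {e : EuclideanSpace ℝ (Fin n)}
    (he : ‖e‖ = 1) {x : ℝ} (hx : 0 ≤ x) (μ : ℝ) :
    ENNReal.ofReal (Real.exp (-(x ^ 2) / 2) / (20 * (1 + x))) ≤
      noiseLaw n σ {z | σ ^ 2 * x ^ 2 < (μ + inner ℝ e z) ^ 2} := by
  have key : ∀ y : ℝ, σ * x < y → σ ^ 2 * x ^ 2 < y ^ 2 := by
    intro y hy
    rw [← mul_pow]
    exact pow_lt_pow_left₀ hy (by positivity) two_ne_zero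
  rcases le_total 0 μ with hμ | hμ
  -- A shift only helps the tail on its own side; for a negative shift the same bound is used with
  -- `-e`.
  · refine (le_noiseLaw_lt_inner hσ he hx).trans (measure_mono fun z hz => key _ ?_)
    simp only [Set.mem_ofPred_eq] at hz
    linarith
  · refine (le_noiseLaw_lt_inner hσ (e := -e) (by rwa [norm_neg]) hx).trans
      (measure_mono fun z hz => ?_)
    simp only [Set.mem_ofPred_eq, inner_neg_left] at hz ⊢
    have := key (-(μ + inner ℝ e z)) (by linarith)
    rwa [neg_sq] at this

/-- The upper tail of a squared noise with a shift of size at most `σ ρ`. -/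
lemma noiseLaw_lt_add_inner_sq_le {n : ℕ} {σ : ℝ} (hσ : 0 < σ) {e : EuclideanSpace ℝ (Fin n)}
    (he : ‖e‖ = 1) {x ρ : ℝ} (hx : 0 ≤ x) (hρ : 0 ≤ ρ) {μ : ℝ} (hμ : |μ| ≤ σ * ρ) :
    noiseLaw n σ {z | σ ^ 2 * x ^ 2 < (μ + inner ℝ e z) ^ 2} ≤
      ENNReal.ofReal (2 * Real.exp (-(x ^ 2) / 2) * Real.exp (ρ * x)) := by
  -- For `x ≤ ρ` the claimed bound exceeds one. Otherwise the centred noise must exceed `σ(x - ρ)`,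
  -- and `-(x - ρ)²/2 ≤ -x²/2 + ρx`.
  rcases le_total x ρ with h | h
  · refine prob_le_one.trans ?_
    rw [← ENNReal.ofReal_one]
    apply ENNReal.ofReal_le_ofReal
    rw [mul_assoc, ← Real.exp_add]
    have : 1 ≤ Real.exp (-(x ^ 2) / 2 + ρ * x) := Real.one_le_exp (by nlinarith)
    linarith
  · have hsub : {z | σ ^ 2 * x ^ 2 < (μ + inner ℝ e z) ^ 2} ⊆
        {z | σ * (x - ρ) ≤ |inner ℝ e z|} := by
      intro z hz
      simp only [Set.mem_ofPred_eq] at hz ⊢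
      rw [← mul_pow] at hz
      have h1 := abs_lt_of_sq_lt_sq' (a := σ * x) (b := |μ + inner ℝ e z|)
        (by rwa [sq_abs]) (abs_nonneg _)
      have h2 := abs_add_le μ (inner ℝ e z)
      nlinarith [h1.2]
    refine (measure_mono hsub).trans
      ((noiseLaw_le_abs_inner hσ he (sub_nonneg.2 h)).trans ?_)
    apply ENNReal.ofReal_le_ofReal
    rw [mul_assoc, ← Real.exp_add]
    have : Real.exp (-((x - ρ) ^ 2) / 2) ≤ Real.exp (-(x ^ 2) / 2 + ρ * x) :=
      Real.exp_le_exp.2 (by nlinarith [sq_nonneg ρ])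
    linarith

/-! ### Removing the leading eigenvectors of a low-rank perturbation -/

section Perturbation

variable {E : Type*} [NormedAddCommGroup E] [InnerProductSpace ℝ E]
  {κ ν : Type*}

lemma norm_sq_sum_smul_orthonormal {v : κ → E} (hv : Orthonormal ℝ v) (s : Finset κ)
    (c : κ → ℝ) : ‖∑ k ∈ s, c k • v k‖ ^ 2 = ∑ k ∈ s, c k ^ 2 := by
  rw [← real_inner_self_eq_norm_sq, hv.inner_sum]
  simp [sq]

lemma sum_inner_sq_le_norm_sq {v : κ → E} (hv : Orthonormal ℝ v) (s : Finset κ) (x : E) :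
    ∑ k ∈ s, inner ℝ (v k) x ^ 2 ≤ ‖x‖ ^ 2 := by
  have := hv.sum_inner_products_le x (s := s)
  simpa using this

lemma inner_sum_smul_orthonormal [DecidableEq κ] {v : κ → E} (hv : Orthonormal ℝ v)
    (s : Finset κ) (c : κ → ℝ) (l : κ) :
    inner ℝ (v l) (∑ k ∈ s, c k • v k) = if l ∈ s then c l else 0 := by
  rw [inner_sum]
  simp only [inner_smul_right, orthonormal_iff_ite.1 hv, mul_ite, mul_one, mul_zero]
  simp

variable [Fintype κ] [Fintype ν] {G : E →ₗ[ℝ] E} {lam : κ → ℝ} {v : κ → E} {θ : ν → ℝ} {w : ν → E} {c Λ : ℝ}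

lemma sum_mul_inner_sq_add_inner_eq
    (hT : ∀ x, ∑ l, (lam l * inner ℝ (v l) x) • v l + G x = ∑ k, (θ k * inner ℝ (w k) x) • w k)
    (x : E) :
    ∑ l, lam l * inner ℝ (v l) x ^ 2 + inner ℝ x (G x) = ∑ k, θ k * inner ℝ (w k) x ^ 2 := by
  have := congrArg (fun y => inner ℝ x y) (hT x)
  simp only [inner_add_right, inner_sum, inner_smul_right] at this
  have h1 : ∀ l, lam l * inner ℝ (v l) x ^ 2 = lam l * inner ℝ (v l) x * inner ℝ x (v l) := by
    intro l; rw [real_inner_comm x]; ring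
  have h2 : ∀ l, θ l * inner ℝ (w l) x ^ 2 = θ l * inner ℝ (w l) x * inner ℝ x (w l) := by
    intro l; rw [real_inner_comm x]; ring
  simp only [h1, h2, this]

/-- There is a gap in the spectrum: each eigenvalue is either of the size of the bounded part
or of the size of the factors. -/
lemma eigenvalue_gap (hc : 0 < c) (hΛ : 0 < Λ) (hv : Orthonormal ℝ v) (hw : Orthonormal ℝ w)
    (hGnorm : ∀ x, ‖G x‖ ≤ c * ‖x‖) (hlam : ∀ l, Λ ≤ lam l)
    (hT : ∀ x, ∑ l, (lam l * inner ℝ (v l) x) • v l + G x = ∑ k, (θ k * inner ℝ (w k) x) • w k)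
    (k : ν) (hk : θ k ≤ Λ / 2) : θ k ≤ 3 * c := by
  classical
  set u := w k with hu
  have hu1 : ‖u‖ = 1 := hw.1 k
  have hTu : ∑ l, (lam l * inner ℝ (v l) u) • v l + G u = θ k • u := by
    rw [hT u, hu]
    simp [orthonormal_iff_ite.1 hw]
  have hGu : ‖G u‖ ≤ c := by simpa [hu1] using hGnorm u
  -- Pairing the eigenvector equation with `v l` gives `(θ - λ)⟨v, u⟩ = ⟨v, G u⟩`, and `θ ≤ Λ/2 ≤
  -- λ/2` gives `λ ≤ 2|θ - λ|`. The factor part of `θ u` then has norm at most `2c` and the `G` part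
  -- at most `c`.
  have hl : ∀ l, (lam l * inner ℝ (v l) u) ^ 2 ≤ 4 * inner ℝ (v l) (G u) ^ 2 := by
    intro l
    have h1 := congrArg (fun y => inner ℝ (v l) y) hTu
    simp only [inner_add_right, inner_smul_right] at h1
    rw [inner_sum_smul_orthonormal hv] at h1
    simp only [Finset.mem_univ, if_true] at h1
    have h2 : inner ℝ (v l) (G u) = (θ k - lam l) * inner ℝ (v l) u := by linarith
    rw [h2, mul_pow, mul_pow, ← mul_assoc]
    have h3 : lam l ^ 2 ≤ 4 * (θ k - lam l) ^ 2 := by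
      have := hlam l
      nlinarith
    exact mul_le_mul_of_nonneg_right h3 (sq_nonneg _)
  have h4 : ‖∑ l, (lam l * inner ℝ (v l) u) • v l‖ ^ 2 ≤ (2 * c) ^ 2 := by
    rw [norm_sq_sum_smul_orthonormal hv]
    calc _ ≤ ∑ l, 4 * inner ℝ (v l) (G u) ^ 2 := Finset.sum_le_sum fun l _ => hl l
      _ = 4 * ∑ l, inner ℝ (v l) (G u) ^ 2 := by rw [Finset.mul_sum]
      _ ≤ 4 * ‖G u‖ ^ 2 := by gcongr; exact sum_inner_sq_le_norm_sq hv _ _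
      _ ≤ 4 * c ^ 2 := by gcongr
      _ = _ := by ring
  have h5 := le_of_sq_le_sq h4 (by positivity)
  have h6 : θ k ≤ ‖θ k • u‖ := by rw [norm_smul, hu1, mul_one]; exact le_abs_self _
  rw [← hTu] at h6
  have h7 := norm_add_le (∑ l, (lam l * inner ℝ (v l) u) • v l) (G u)
  linarith

/-- No matching of individual eigenvectors is needed. Let `T` be the full operator, `P` the
projection of `b` onto the removed eigenvectors and `W = T(b - P)`. Then `⟨a, W⟩` equals `⟨a, G b⟩`
plus `∑ λ⟨v, b - P⟩⟨v, a⟩` minus `⟨G a, P⟩`. Vectors with bounded `T`-quadratic form have components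
of squared size `O(1/Λ)` along the factors and along the removed eigenvectors. Both error terms pair
two families of size `O(Λ^{-1/2})`, and Cauchy–Schwarz gives `O(1/Λ)`. -/
lemma abs_inner_adjusted_sub_le [DecidableEq ν] (hc : 0 < c) (hΛ : 0 < Λ)
    (hv : Orthonormal ℝ v) (hw : Orthonormal ℝ w)
    (hGsymm : ∀ x y, inner ℝ (G x) y = inner ℝ x (G y)) (hGpos : ∀ x, 0 ≤ inner ℝ x (G x))
    (hGnorm : ∀ x, ‖G x‖ ≤ c * ‖x‖) (hlam : ∀ l, Λ ≤ lam l) (hθ : ∀ k, 0 ≤ θ k)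
    (hT : ∀ x, ∑ l, (lam l * inner ℝ (v l) x) • v l + G x = ∑ k, (θ k * inner ℝ (w k) x) • w k)
    (A : Finset ν) (hA : ∀ k ∈ A, Λ / 2 ≤ θ k) (hA' : ∀ k ∉ A, θ k ≤ 3 * c)
    {a b : E} (hb1 : ‖b‖ = 1)
    (ha : ∑ k, θ k * inner ℝ (w k) a ^ 2 ≤ 1) (hb : ∑ k, θ k * inner ℝ (w k) b ^ 2 ≤ 1)
    (hGa : ∑ k, θ k * inner ℝ (w k) (G a) ^ 2 ≤ c ^ 2)
    (hGb : ∑ k, θ k * inner ℝ (w k) (G b) ^ 2 ≤ c ^ 2) :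
    |∑ k ∈ Aᶜ, θ k * inner ℝ (w k) a * inner ℝ (w k) b - inner ℝ a (G b)| ≤
      (√(54 * c ^ 3 + 12 * c ^ 2) + 2 * c) / Λ := by
  classical
  have hquad := sum_mul_inner_sq_add_inner_eq hT
  have hΛv : ∀ x, ∑ l, inner ℝ (v l) x ^ 2 ≤ (∑ k, θ k * inner ℝ (w k) x ^ 2) / Λ := by
    intro x
    rw [le_div_iff₀ hΛ, ← hquad x, Finset.sum_mul]
    have : ∑ l, inner ℝ (v l) x ^ 2 * Λ ≤ ∑ l, lam l * inner ℝ (v l) x ^ 2 :=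
      Finset.sum_le_sum fun l _ => by
        rw [mul_comm]; exact mul_le_mul_of_nonneg_right (hlam l) (sq_nonneg _)
    linarith [hGpos x]
  have hΛw : ∀ x, ∑ k ∈ A, inner ℝ (w k) x ^ 2 ≤ 2 * (∑ k, θ k * inner ℝ (w k) x ^ 2) / Λ := by
    intro x
    rw [le_div_iff₀ hΛ, Finset.sum_mul, Finset.mul_sum]
    calc ∑ k ∈ A, inner ℝ (w k) x ^ 2 * Λ ≤ ∑ k ∈ A, 2 * (θ k * inner ℝ (w k) x ^ 2) :=
          Finset.sum_le_sum fun k hk => by nlinarith [hA k hk, sq_nonneg (inner ℝ (w k) x)]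
      _ ≤ _ := Finset.sum_le_univ_sum_of_nonneg fun k =>
          mul_nonneg zero_le_two (mul_nonneg (hθ k) (sq_nonneg _))
  set P := ∑ k ∈ A, inner ℝ (w k) b • w k with hP
  set W := ∑ k ∈ Aᶜ, (θ k * inner ℝ (w k) b) • w k with hW
  have hQ : ∀ k, inner ℝ (w k) (b - P) = if k ∈ A then 0 else inner ℝ (w k) b := by
    intro k
    rw [inner_sub_right, hP, inner_sum_smul_orthonormal hw]
    split_ifs <;> simp
  have hTQ : ∑ l, (lam l * inner ℝ (v l) (b - P)) • v l + G (b - P) = W := by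
    rw [hT, hW, ← Finset.sum_add_sum_compl A]
    rw [Finset.sum_eq_zero (s := A), zero_add]
    · refine Finset.sum_congr rfl fun k hk => ?_
      rw [hQ, if_neg (Finset.mem_compl.1 hk)]
    · intro k hk
      rw [hQ, if_pos hk]; simp
  have hPn : ‖P‖ ^ 2 ≤ 2 / Λ := by
    rw [hP, norm_sq_sum_smul_orthonormal hw]
    refine (hΛw b).trans ?_
    gcongr; linarith
  have hWn : ‖W‖ ^ 2 ≤ 9 * c ^ 2 := by
    rw [hW, norm_sq_sum_smul_orthonormal hw]
    calc ∑ k ∈ Aᶜ, (θ k * inner ℝ (w k) b) ^ 2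
        ≤ ∑ k ∈ Aᶜ, (3 * c) ^ 2 * inner ℝ (w k) b ^ 2 := by
          refine Finset.sum_le_sum fun k hk => ?_
          rw [mul_pow]
          have := hA' k (Finset.mem_compl.1 hk)
          have := hθ k
          gcongr
      _ = (3 * c) ^ 2 * ∑ k ∈ Aᶜ, inner ℝ (w k) b ^ 2 := by rw [Finset.mul_sum]
      _ ≤ (3 * c) ^ 2 * ‖b‖ ^ 2 := by gcongr; exact sum_inner_sq_le_norm_sq hw _ _
      _ = _ := by rw [hb1]; ring
  -- `W` lies in the span of the eigenvectors that are kept, where `θ ≤ 3c`.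
  have hWq : ∑ k, θ k * inner ℝ (w k) W ^ 2 ≤ 27 * c ^ 3 := by
    calc ∑ k, θ k * inner ℝ (w k) W ^ 2 ≤ ∑ k, 3 * c * inner ℝ (w k) W ^ 2 := by
          refine Finset.sum_le_sum fun k _ => ?_
          by_cases hk : k ∈ A
          · rw [hW, inner_sum_smul_orthonormal hw]; simp [hk]
          · exact mul_le_mul_of_nonneg_right (hA' k hk) (sq_nonneg _)
      _ = 3 * c * ∑ k, inner ℝ (w k) W ^ 2 := by rw [Finset.mul_sum]
      _ ≤ 3 * c * ‖W‖ ^ 2 := by gcongr; exact sum_inner_sq_le_norm_sq hw _ _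
      _ ≤ 3 * c * (9 * c ^ 2) := by gcongr
      _ = _ := by ring
  have hGQ : ∑ l, inner ℝ (v l) (G (b - P)) ^ 2 ≤ 6 * c ^ 2 / Λ := by
    calc ∑ l, inner ℝ (v l) (G (b - P)) ^ 2
        ≤ ∑ l, (2 * inner ℝ (v l) (G b) ^ 2 + 2 * inner ℝ (v l) (G P) ^ 2) := by
          refine Finset.sum_le_sum fun l _ => ?_
          rw [map_sub, inner_sub_right]
          nlinarith [sq_nonneg (inner ℝ (v l) (G b) + inner ℝ (v l) (G P))]
      _ = 2 * ∑ l, inner ℝ (v l) (G b) ^ 2 + 2 * ∑ l, inner ℝ (v l) (G P) ^ 2 := by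
          rw [Finset.sum_add_distrib, Finset.mul_sum, Finset.mul_sum]
      _ ≤ 2 * (c ^ 2 / Λ) + 2 * (c ^ 2 * (2 / Λ)) := by
          gcongr
          · exact (hΛv (G b)).trans (by gcongr)
          · refine (sum_inner_sq_le_norm_sq hv _ _).trans ?_
            calc ‖G P‖ ^ 2 ≤ (c * ‖P‖) ^ 2 := by gcongr; exact hGnorm P
              _ = c ^ 2 * ‖P‖ ^ 2 := by ring
              _ ≤ _ := by gcongr
      _ = _ := by ring
  -- The `lam l` have no upper bound, so these products are read off from the equation `hTQ` rather
  -- than estimated factor by factor.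
  have hcoef : ∀ l, lam l * inner ℝ (v l) (b - P) = inner ℝ (v l) W - inner ℝ (v l) (G (b - P)) := by
    intro l
    have h1 := congrArg (fun y => inner ℝ (v l) y) hTQ
    simp only [inner_add_right] at h1
    rw [inner_sum_smul_orthonormal hv] at h1
    simp only [Finset.mem_univ, if_true] at h1
    linarith
  have hcoef2 : ∑ l, (lam l * inner ℝ (v l) (b - P)) ^ 2 ≤ (54 * c ^ 3 + 12 * c ^ 2) / Λ := by
    calc ∑ l, (lam l * inner ℝ (v l) (b - P)) ^ 2
        ≤ ∑ l, (2 * inner ℝ (v l) W ^ 2 + 2 * inner ℝ (v l) (G (b - P)) ^ 2) := by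
          refine Finset.sum_le_sum fun l _ => ?_
          rw [hcoef]
          nlinarith [sq_nonneg (inner ℝ (v l) W + inner ℝ (v l) (G (b - P)))]
      _ = 2 * ∑ l, inner ℝ (v l) W ^ 2 + 2 * ∑ l, inner ℝ (v l) (G (b - P)) ^ 2 := by
          rw [Finset.sum_add_distrib, Finset.mul_sum, Finset.mul_sum]
      _ ≤ 2 * (27 * c ^ 3 / Λ) + 2 * (6 * c ^ 2 / Λ) := by
          gcongr
          exact (hΛv W).trans (by gcongr)
      _ = _ := by ring
  have hva : ∑ l, inner ℝ (v l) a ^ 2 ≤ 1 / Λ := (hΛv a).trans (by gcongr)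
  have hmain : |∑ l, lam l * inner ℝ (v l) (b - P) * inner ℝ (v l) a| ≤
      √(54 * c ^ 3 + 12 * c ^ 2) / Λ := by
    have h1 := Finset.sum_mul_sq_le_sq_mul_sq Finset.univ
      (fun l => lam l * inner ℝ (v l) (b - P)) (fun l => inner ℝ (v l) a)
    apply abs_le_of_sq_le_sq _ (by positivity)
    rw [div_pow, Real.sq_sqrt (by positivity)]
    refine h1.trans ?_
    calc _ ≤ ((54 * c ^ 3 + 12 * c ^ 2) / Λ) * (1 / Λ) := by gcongr
      _ = _ := by field_simp
  have hPa : |inner ℝ (G a) P| ≤ 2 * c / Λ := by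
    have h0 : inner ℝ (G a) P = ∑ k ∈ A, inner ℝ (w k) b * inner ℝ (w k) (G a) := by
      rw [hP, inner_sum]
      simp only [inner_smul_right, real_inner_comm (G a)]
    have h1 := Finset.sum_mul_sq_le_sq_mul_sq A
      (fun k => inner ℝ (w k) b) (fun k => inner ℝ (w k) (G a))
    apply abs_le_of_sq_le_sq _ (by positivity)
    rw [h0]
    refine h1.trans ?_
    calc _ ≤ (2 * 1 / Λ) * (2 * c ^ 2 / Λ) := by
          gcongr
          · exact (hΛw b).trans (by gcongr)
          · exact (hΛw (G a)).trans (by gcongr)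
      _ = _ := by ring
  have hsum : ∑ k ∈ Aᶜ, θ k * inner ℝ (w k) a * inner ℝ (w k) b = inner ℝ a W := by
    rw [hW, inner_sum]
    refine Finset.sum_congr rfl fun k _ => ?_
    rw [inner_smul_right, real_inner_comm a]; ring
  have hexp : inner ℝ a W = ∑ l, lam l * inner ℝ (v l) (b - P) * inner ℝ (v l) a +
      inner ℝ a (G b) - inner ℝ (G a) P := by
    rw [← hTQ, inner_add_right, inner_sum, map_sub, inner_sub_right, hGsymm]
    simp only [inner_smul_right, real_inner_comm a]
    ring
  rw [hsum, hexp]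
  have := abs_sub (∑ l, lam l * inner ℝ (v l) (b - P) * inner ℝ (v l) a) (inner ℝ (G a) P)
  rw [add_div]
  calc _ = |∑ l, lam l * inner ℝ (v l) (b - P) * inner ℝ (v l) a - inner ℝ (G a) P| := by
        congr 1; ring
    _ ≤ _ := this
    _ ≤ _ := add_le_add hmain hPa

end Perturbation

/-! ### The factor-adjusted data -/

lemma gram_eq_inner {n p : ℕ} (X : Matrix (Fin n) (Fin p) ℝ) (i j : Fin p) :
    gram X i j = (1 / (n : ℝ)) * inner ℝ (col X i) (col X j) := by
  simp [gram, col, Matrix.mul_apply, PiLp.inner_apply, mul_comm]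

lemma gram_self_eq {n p : ℕ} (X : Matrix (Fin n) (Fin p) ℝ) (j : Fin p) :
    gram X j j = ‖col X j‖ ^ 2 / n := by
  rw [gram_eq_inner, real_inner_self_eq_norm_sq]; ring

lemma toLp_mulVec_eq_sum {n p : ℕ} (X : Matrix (Fin n) (Fin p) ℝ) (β : Fin p → ℝ) :
    (WithLp.toLp 2 (X.mulVec β) : EuclideanSpace ℝ (Fin n)) = ∑ j, β j • col X j := by
  ext i
  simp [col, Matrix.mulVec, dotProduct, mul_comm]

namespace SVD

variable {n p : ℕ} {X : Matrix (Fin n) (Fin p) ℝ} (D : SVD X)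

/-- Since the singular values are ordered, those above the level form an initial segment: the
components removed are exactly those above it. -/
lemma lt_numFactors_iff (k : Fin (min n p)) :
    (k : ℕ) < D.numFactors ↔ (n : ℝ) * Real.log p < D.sing k ^ 2 := by
  unfold numFactors
  rw [Finset.lt_sup_iff]
  constructor
  · rintro ⟨l, hl, hkl⟩
    rw [Finset.mem_filter] at hl
    have : D.sing l ≤ D.sing k := D.sing_antitone (by rw [Fin.le_def]; omega)
    exact hl.2.trans_le (pow_le_pow_left₀ (D.sing_nonneg l) this 2)
  · intro h
    exact ⟨k, by simpa using h, Nat.lt_succ_self _⟩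

lemma inner_adjVec_left (N : ℕ) (y : EuclideanSpace ℝ (Fin n)) {k : Fin (min n p)} (hk : (k : ℕ) < N) :
    inner ℝ (D.adjVec N y) (D.left k) = 0 := by
  rw [real_inner_comm, adjVec, inner_sub_right,
    inner_sum_smul_orthonormal D.left_orthonormal, if_pos (by simpa using hk), sub_self]

lemma inner_adjVec_adjVec (N : ℕ) (x y : EuclideanSpace ℝ (Fin n)) :
    inner ℝ (D.adjVec N x) (D.adjVec N y) = inner ℝ (D.adjVec N x) y := by
  conv_lhs => rw [adjVec.eq_1 D N y]
  rw [inner_sub_right, inner_sum, Finset.sum_eq_zero, sub_zero]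
  intro k hk
  rw [inner_smul_right, inner_adjVec_left D N x (by simpa using hk), mul_zero]

lemma norm_adjVec_le (N : ℕ) (y : EuclideanSpace ℝ (Fin n)) : ‖D.adjVec N y‖ ≤ ‖y‖ := by
  have h := D.inner_adjVec_adjVec N y y
  have h2 := real_inner_le_norm (D.adjVec N y) y
  rw [← h, real_inner_self_eq_norm_sq, sq] at h2
  by_contra! hlt
  have : 0 < ‖D.adjVec N y‖ := (norm_nonneg y).trans_lt hlt
  nlinarith

/-- The adjustment as a linear map. -/
def adjLin (N : ℕ) : EuclideanSpace ℝ (Fin n) →ₗ[ℝ] EuclideanSpace ℝ (Fin n) where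
  toFun := D.adjVec N
  map_add' x y := by
    simp only [adjVec, inner_add_right, add_smul, Finset.sum_add_distrib]; abel
  map_smul' c x := by
    simp only [adjVec, inner_smul_right, mul_smul, RingHom.id_apply, smul_sub, Finset.smul_sum]

lemma adjLin_apply (N : ℕ) (y : EuclideanSpace ℝ (Fin n)) : D.adjLin N y = D.adjVec N y := rfl

lemma continuous_adjVec (N : ℕ) : Continuous (D.adjVec N) :=
  (D.adjLin N).continuous_of_finiteDimensional

lemma col_eq_sum (j : Fin p) : col X j = ∑ k, (D.sing k * D.right k j) • D.left k := by
  ext i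
  simp only [col, D.eq_sum, WithLp.ofLp_sum, WithLp.ofLp_smul, Finset.sum_apply, Pi.smul_apply,
    smul_eq_mul]
  exact Finset.sum_congr rfl fun k _ => by ring

lemma col_adjMat_eq_sum (N : ℕ) (j : Fin p) :
    col (D.adjMat N) j = ∑ k ∈ (Finset.univ.filter (fun k : Fin (min n p) => (k : ℕ) < N))ᶜ,
      (D.sing k * D.right k j) • D.left k := by
  rw [eq_sub_of_add_eq' (Finset.sum_add_sum_compl
    (Finset.univ.filter (fun k : Fin (min n p) => (k : ℕ) < N))
    (fun k => (D.sing k * D.right k j) • D.left k)), ← col_eq_sum]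
  ext i
  simp only [col, adjMat, Matrix.of_apply, WithLp.ofLp_sub, WithLp.ofLp_sum, WithLp.ofLp_smul,
    Finset.sum_apply, Pi.smul_apply, smul_eq_mul, Pi.sub_apply]
  congr 1
  exact Finset.sum_congr rfl fun k _ => by ring

lemma adjVec_col (N : ℕ) (j : Fin p) : D.adjVec N (col X j) = col (D.adjMat N) j := by
  rw [col_adjMat_eq_sum, eq_sub_of_add_eq' (Finset.sum_add_sum_compl
    (Finset.univ.filter (fun k : Fin (min n p) => (k : ℕ) < N))
    (fun k => (D.sing k * D.right k j) • D.left k)), ← col_eq_sum, adjVec]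
  congr 1
  refine Finset.sum_congr rfl fun k _ => ?_
  rw [D.col_eq_sum j, inner_sum_smul_orthonormal D.left_orthonormal, if_pos (Finset.mem_univ _)]

lemma adjVec_response (N : ℕ) (β : Fin p → ℝ) (z : EuclideanSpace ℝ (Fin n)) :
    D.adjVec N (response X β z) = ∑ j, β j • col (D.adjMat N) j + D.adjVec N z := by
  rw [← adjLin_apply, response, map_add, toLp_mulVec_eq_sum, map_sum]
  simp only [map_smul, adjLin_apply, adjVec_col]

/-- The adjustment is an orthogonal projection and the adjusted columns lie in its range. A
direction in their span therefore sees the original noise, so adjusting does not change its variance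
there. -/
lemma inner_adjVec_of_mem_span (N : ℕ) {e : EuclideanSpace ℝ (Fin n)}
    (he : e ∈ Submodule.span ℝ (Set.range (col (D.adjMat N)))) (z : EuclideanSpace ℝ (Fin n)) :
    inner ℝ e (D.adjVec N z) = inner ℝ e z := by
  have : Submodule.span ℝ (Set.range (col (D.adjMat N))) ≤ LinearMap.range (D.adjLin N) := by
    rw [Submodule.span_le]
    rintro _ ⟨j, rfl⟩
    exact ⟨col X j, D.adjVec_col N j⟩
  obtain ⟨x, rfl⟩ := this he
  exact D.inner_adjVec_adjVec N x z

lemma norm_col_adjMat_le (N : ℕ) (j : Fin p) : ‖col (D.adjMat N) j‖ ≤ ‖col X j‖ := by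
  rw [← adjVec_col]; exact D.norm_adjVec_le N _

lemma gram_eq_sum (i j : Fin p) :
    gram X i j = ∑ k, D.sing k ^ 2 / n * D.right k i * D.right k j := by
  rw [gram_eq_inner, D.col_eq_sum i, D.col_eq_sum j, D.left_orthonormal.inner_sum, Finset.mul_sum]
  refine Finset.sum_congr rfl fun k _ => ?_
  simp; ring

lemma gram_adjMat_eq_sum (N : ℕ) (i j : Fin p) :
    gram (D.adjMat N) i j =
      ∑ k ∈ (Finset.univ.filter (fun k : Fin (min n p) => (k : ℕ) < N))ᶜ,
        D.sing k ^ 2 / n * D.right k i * D.right k j := by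
  rw [gram_eq_inner, D.col_adjMat_eq_sum, D.col_adjMat_eq_sum, D.left_orthonormal.inner_sum,
    Finset.mul_sum]
  refine Finset.sum_congr rfl fun k _ => ?_
  simp; ring

end SVD

/-! ### The adjusted Gram matrix is entrywise close to the sparse part -/

section Gram

variable {p : ℕ}

lemma inner_toEuclideanLin (G : Matrix (Fin p) (Fin p) ℝ) (x y : EuclideanSpace ℝ (Fin p)) :
    inner ℝ x (Matrix.toEuclideanLin G y) = ∑ i, ∑ j, x i * G i j * y j := by
  simp [PiLp.inner_apply, Matrix.mulVec, dotProduct, Finset.sum_mul]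
  exact Finset.sum_congr rfl fun i _ => Finset.sum_congr rfl fun j _ => by ring

lemma abs_apply_le_one_of_posSemidef {G : Matrix (Fin p) (Fin p) ℝ} (hG : G.PosSemidef)
    (hd : ∀ i, G i i ≤ 1) (i j : Fin p) : |G i j| ≤ 1 := by
  have hs : G j i = G i j := by simpa using hG.1.apply i j
  have hq : ∀ x : Fin p → ℝ, 0 ≤ x ⬝ᵥ G.mulVec x := fun x => by
    simpa using hG.dotProduct_mulVec_nonneg x
  have h1 := hq (Pi.single i 1 + Pi.single j 1)
  have h2 := hq (Pi.single i 1 - Pi.single j 1)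
  simp [Matrix.mulVec_add, Matrix.mulVec_sub, hs] at h1 h2
  rw [abs_le]
  constructor <;> linarith [hd i, hd j]

/-- Schur's test: Cauchy–Schwarz with weights `|G i j|`, then symmetry turns column sums into row
sums. -/
lemma norm_toEuclideanLin_le {G : Matrix (Fin p) (Fin p) ℝ} {c : ℝ} (hc : 0 ≤ c)
    (hs : ∀ i j, G i j = G j i) (hrow : ∀ i, ∑ j, |G i j| ≤ c) (x : EuclideanSpace ℝ (Fin p)) :
    ‖Matrix.toEuclideanLin G x‖ ≤ c * ‖x‖ := by
  apply le_of_sq_le_sq _ (by positivity)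
  rw [EuclideanSpace.real_norm_sq_eq, mul_pow, EuclideanSpace.real_norm_sq_eq]
  have h1 : ∀ i, (Matrix.toEuclideanLin G x) i ^ 2 ≤ c * ∑ j, |G i j| * x j ^ 2 := by
    intro i
    have e : (Matrix.toEuclideanLin G x) i = ∑ j, G i j * x j := by
      simp [Matrix.mulVec, dotProduct]
    rw [e]
    have := Finset.sum_sq_le_sum_mul_sum_of_sq_le_mul Finset.univ
      (r := fun j => G i j * x j) (f := fun j => |G i j|) (g := fun j => |G i j| * x j ^ 2)
      (fun j _ => abs_nonneg _) (fun j _ => by positivity)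
      (fun j _ => by rw [mul_pow, ← sq_abs (G i j)]; exact le_of_eq (by ring))
    refine this.trans ?_
    gcongr
    exact hrow i
  calc ∑ i, (Matrix.toEuclideanLin G x) i ^ 2 ≤ ∑ i, c * ∑ j, |G i j| * x j ^ 2 :=
        Finset.sum_le_sum fun i _ => h1 i
    _ = c * ∑ j, (∑ i, |G j i|) * x j ^ 2 := by
        rw [← Finset.mul_sum, Finset.sum_comm]
        congr 1
        refine Finset.sum_congr rfl fun j _ => ?_
        rw [Finset.sum_mul]
        exact Finset.sum_congr rfl fun i _ => by rw [hs]
    _ ≤ c * ∑ j, c * x j ^ 2 := by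
        gcongr with j
        exact hrow j
    _ = _ := by rw [← Finset.mul_sum]; ring

/-- A positive semidefinite matrix with unit diagonal has entries of size at most one, so its
quadratic form is at most the squared `ℓ¹` norm. This controls the form at basis vectors and at rows
of `G` independently of how large the factors are. -/
lemma sum_mul_inner_sq_le {ν : Type*} [Fintype ν] {θ : ν → ℝ} (hθ : ∀ k, 0 ≤ θ k)
    {w : ν → EuclideanSpace ℝ (Fin p)} (hd : ∀ i, ∑ k, θ k * w k i * w k i = 1)
    (x : EuclideanSpace ℝ (Fin p)) :
    ∑ k, θ k * inner ℝ (w k) x ^ 2 ≤ (∑ i, |x i|) ^ 2 := by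
  have h1 : ∀ i j, |∑ k, θ k * w k i * w k j| ≤ 1 := by
    intro i j
    calc |∑ k, θ k * w k i * w k j| ≤ ∑ k, |θ k * w k i * w k j| := Finset.abs_sum_le_sum_abs _ _
      _ ≤ ∑ k, (θ k * w k i * w k i + θ k * w k j * w k j) / 2 := by
          refine Finset.sum_le_sum fun k _ => ?_
          rw [mul_assoc, abs_mul, abs_of_nonneg (hθ k), mul_assoc, mul_assoc, ← mul_add, mul_div_assoc]
          apply mul_le_mul_of_nonneg_left _ (hθ k)
          rw [abs_le]
          constructor <;> nlinarith [sq_nonneg (w k i + w k j), sq_nonneg (w k i - w k j)]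
      _ = 1 := by rw [← Finset.sum_div, Finset.sum_add_distrib, hd, hd]; norm_num
  calc ∑ k, θ k * inner ℝ (w k) x ^ 2
      = ∑ i, ∑ j, x i * x j * ∑ k, θ k * w k i * w k j := by
        simp only [Finset.mul_sum]
        rw [Finset.sum_congr rfl fun i _ => Finset.sum_comm, Finset.sum_comm]
        refine Finset.sum_congr rfl fun k _ => ?_
        have : inner ℝ (w k) x = ∑ i, x i * w k i := by simp [PiLp.inner_apply]
        rw [this, sq, Finset.sum_mul_sum, Finset.mul_sum]
        refine Finset.sum_congr rfl fun i _ => ?_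
        rw [Finset.mul_sum]
        exact Finset.sum_congr rfl fun j _ => by ring
    _ ≤ ∑ i, ∑ j, |x i| * |x j| := by
        refine Finset.sum_le_sum fun i _ => Finset.sum_le_sum fun j _ => ?_
        refine (le_abs_self _).trans ?_
        rw [abs_mul, abs_mul]
        exact mul_le_of_le_one_right (by positivity) (h1 i j)
    _ = _ := by rw [sq, Finset.sum_mul_sum]

lemma sum_smul_inner_smul_apply {ν : Type*} [Fintype ν] (l : ν → ℝ)
    (u : ν → EuclideanSpace ℝ (Fin p)) (x : EuclideanSpace ℝ (Fin p)) (i : Fin p) :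
    (∑ k, (l k * inner ℝ (u k) x) • u k) i = ∑ j, (∑ k, l k * u k i * u k j) * x j := by
  simp only [WithLp.ofLp_sum, WithLp.ofLp_smul, Finset.sum_apply, Pi.smul_apply, smul_eq_mul,
    Finset.sum_mul]
  rw [Finset.sum_comm]
  refine Finset.sum_congr rfl fun k _ => ?_
  simp only [PiLp.inner_apply, Finset.mul_sum, Finset.sum_mul]
  refine Finset.sum_congr rfl fun j _ => ?_
  simp; ring

/-- Entrywise, the factor-adjusted Gram matrix differs from the sparse part of the Gram matrix
by a multiple of the inverse of the smallest factor. -/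
theorem abs_gram_adjMat_sub_le {n : ℕ} {X : Matrix (Fin n) (Fin p) ℝ} (D : SVD X) (hn : 0 < n)
    {κ : Type*} [Fintype κ] {lam : κ → ℝ} {v : κ → EuclideanSpace ℝ (Fin p)}
    {G : Matrix (Fin p) (Fin p) ℝ} {c Λ : ℝ} (hc : 0 < c) (hΛ : 0 < Λ)
    (hv : Orthonormal ℝ v) (hΘ : ∀ i j, gram X i j = ∑ k, lam k * v k i * v k j + G i j)
    (hdiag : ∀ j, gram X j j = 1) (hG : G.PosSemidef) (hrow : ∀ i, ∑ j, |G i j| ≤ c)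
    (hlam : ∀ k, Λ ≤ lam k) (hlog : 3 * c ≤ Real.log p) (hlogΛ : Real.log p ≤ Λ / 2)
    (i j : Fin p) :
    |gram (D.adjMat D.numFactors) i j - G i j| ≤
      (√(54 * c ^ 3 + 12 * c ^ 2) + 2 * c) / Λ := by
  have hn' : (0 : ℝ) < n := by exact_mod_cast hn
  have hs : ∀ i j, G i j = G j i := fun i j => by simpa using hG.1.apply j i
  have hT : ∀ x : EuclideanSpace ℝ (Fin p),
      ∑ l, (lam l * inner ℝ (v l) x) • v l + Matrix.toEuclideanLin G x =
        ∑ k, (D.sing k ^ 2 / n * inner ℝ (D.right k) x) • D.right k := by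
    intro x
    ext i
    have hadd : ∀ a b : EuclideanSpace ℝ (Fin p), (a + b) i = a i + b i := fun _ _ => rfl
    have e : (Matrix.toEuclideanLin G x) i = ∑ j, G i j * x j := by
      simp [Matrix.mulVec, dotProduct]
    rw [hadd, sum_smul_inner_smul_apply, sum_smul_inner_smul_apply, e, ← Finset.sum_add_distrib]
    refine Finset.sum_congr rfl fun j _ => ?_
    rw [← add_mul, ← hΘ, D.gram_eq_sum]
  have hGsymm : ∀ x y : EuclideanSpace ℝ (Fin p),
      inner ℝ (Matrix.toEuclideanLin G x) y = inner ℝ x (Matrix.toEuclideanLin G y) := by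
    intro x y
    rw [real_inner_comm, inner_toEuclideanLin, inner_toEuclideanLin, Finset.sum_comm]
    exact Finset.sum_congr rfl fun i _ => Finset.sum_congr rfl fun j _ => by rw [hs j i]; ring
  have hGpos : ∀ x : EuclideanSpace ℝ (Fin p), 0 ≤ inner ℝ x (Matrix.toEuclideanLin G x) := by
    intro x
    rw [inner_toEuclideanLin]
    have := hG.dotProduct_mulVec_nonneg x.ofLp
    simpa [Matrix.mulVec, dotProduct, Finset.mul_sum, mul_assoc] using this
  have hGnorm := norm_toEuclideanLin_le hc.le hs hrow
  have hθ : ∀ k, 0 ≤ D.sing k ^ 2 / n := fun k => by positivity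
  have hgap := eigenvalue_gap hc hΛ hv D.right_orthonormal hGnorm hlam hT
  have hd : ∀ i, ∑ k, D.sing k ^ 2 / n * D.right k i * D.right k i = 1 := fun i => by
    rw [← D.gram_eq_sum, hdiag]
  have hq := sum_mul_inner_sq_le hθ hd
  have hsingle : ∀ i : Fin p, ∑ k, D.sing k ^ 2 / n *
      inner ℝ (D.right k) (EuclideanSpace.single i (1 : ℝ)) ^ 2 ≤ 1 := by
    intro i
    refine (hq _).trans ?_
    have : ∑ j, |(EuclideanSpace.single i (1 : ℝ)) j| = 1 := by
      rw [Finset.sum_eq_single i] <;> simp +contextual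
    rw [this, one_pow]
  have hGsingle : ∀ i : Fin p, ∑ k, D.sing k ^ 2 / n *
      inner ℝ (D.right k) (Matrix.toEuclideanLin G (EuclideanSpace.single i (1 : ℝ))) ^ 2
        ≤ c ^ 2 := by
    intro i
    refine (hq _).trans ?_
    have : ∀ j, (Matrix.toEuclideanLin G (EuclideanSpace.single i (1 : ℝ))) j = G i j := by
      intro j; rw [hs i j]; simp
    simp only [this]
    have h0 : 0 ≤ ∑ j, |G i j| := Finset.sum_nonneg fun _ _ => abs_nonneg _
    exact pow_le_pow_left₀ h0 (hrow i) 2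
  -- The cut at `log p` falls inside the spectral gap between `3c` and `Λ/2`, so the removed indices
  -- are the factor-sized ones and the kept eigenvalues are at most `3c`.
  have hmain := abs_inner_adjusted_sub_le hc hΛ hv D.right_orthonormal hGsymm hGpos hGnorm hlam hθ
    hT (Finset.univ.filter (fun k : Fin (min n p) => (k : ℕ) < D.numFactors))
    (fun k hk => by
      have h1 := (D.lt_numFactors_iff k).1 (by simpa using hk)
      by_contra! h2
      have h3 := hgap k h2.le
      rw [div_le_iff₀ hn'] at h3
      nlinarith)
    (fun k hk => by
      have h1 := mt (D.lt_numFactors_iff k).2 (by simpa using hk)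
      refine hgap k (le_trans ?_ hlogΛ)
      rw [div_le_iff₀ hn']
      linarith)
    (a := EuclideanSpace.single i 1) (b := EuclideanSpace.single j 1) (by simp)
    (hsingle i) (hsingle j) (hGsingle i) (hGsingle j)
  rw [D.gram_adjMat_eq_sum]
  have h1 : ∀ (x : EuclideanSpace ℝ (Fin p)) (i : Fin p),
      inner ℝ x (EuclideanSpace.single i (1 : ℝ)) = x i := fun x i => by
    simp [EuclideanSpace.inner_single_right]
  have h2 : inner ℝ (EuclideanSpace.single i (1 : ℝ))
      (Matrix.toEuclideanLin G (EuclideanSpace.single j (1 : ℝ))) = G i j := by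
    simp [EuclideanSpace.inner_single_left]
  simpa only [h1, h2] using hmain

end Gram

/-! ### Local scores as squared linear functionals -/

/-- The vector `e` is the normalized residual of column `j` after projection onto the other columns
of `I`, so `P_I y` is the smaller projection plus `⟨e, y⟩ e`, orthogonally. If the residual
vanishes, `‖η‖⁻¹ = 0` makes `e = 0` and the score is zero. -/
lemma exists_localScore_eq_sq {n p : ℕ} (X : Matrix (Fin n) (Fin p) ℝ) {j : Fin p}
    {I : Finset (Fin p)} (hj : j ∈ I) :
    ∃ e ∈ Submodule.span ℝ (col X '' (I : Set (Fin p))), (e = 0 ∨ ‖e‖ = 1) ∧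
      ∀ y, localScore X y j I = inner ℝ e y ^ 2 := by
  set U := Submodule.span ℝ (col X '' (I.erase j : Finset (Fin p))) with hU
  set W := Submodule.span ℝ (col X '' (I : Set (Fin p))) with hW
  have hUW : U ≤ W := Submodule.span_mono (Set.image_mono (by simp))
  set η := col X j - U.starProjection (col X j) with hη
  set e := ‖η‖⁻¹ • η with he
  have hηW : η ∈ W := W.sub_mem (Submodule.subset_span ⟨j, hj, rfl⟩)
    (hUW (U.starProjection_apply_mem _))
  have heW : e ∈ W := W.smul_mem _ hηW
  have hηe : η = ‖η‖ • e := by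
    by_cases h : η = 0
    · simp [h]
    · rw [he, smul_smul, mul_inv_cancel₀ (norm_ne_zero_iff.2 h), one_smul]
  have he01 : e = 0 ∨ ‖e‖ = 1 := by
    by_cases h : η = 0
    · left; simp [he, h]
    · right; rw [he, norm_smul, norm_inv, norm_norm, inv_mul_cancel₀ (norm_ne_zero_iff.2 h)]
  have heU : ∀ u ∈ U, inner ℝ e u = 0 := by
    intro u hu
    rw [he, inner_smul_left, hη, U.starProjection_inner_eq_zero _ _ hu, mul_zero]
  refine ⟨e, heW, he01, fun y => ?_⟩
  have hee : inner ℝ e y * inner ℝ e e = inner ℝ e y := by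
    rcases he01 with h | h
    · simp [h]
    · rw [real_inner_self_eq_norm_sq, h]; ring
  have hproj : W.starProjection y = U.starProjection y + inner ℝ e y • e := by
    refine Submodule.eq_starProjection_of_mem_of_inner_eq_zero
      (W.add_mem (hUW (U.starProjection_apply_mem _)) (W.smul_mem _ heW)) ?_
    have hsub : ∀ u ∈ U, inner ℝ (y - (U.starProjection y + inner ℝ e y • e)) u = 0 := by
      intro u hu
      rw [← sub_sub, inner_sub_left, U.starProjection_inner_eq_zero _ _ hu, inner_smul_left,
        heU u hu]
      simp
    have hsube : inner ℝ (y - (U.starProjection y + inner ℝ e y • e)) e = 0 := by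
      rw [inner_sub_left, inner_add_left, inner_smul_left,
        real_inner_comm e (U.starProjection y), heU _ (U.starProjection_apply_mem _),
        real_inner_comm e y]
      simp only [conj_trivial]
      rw [hee]; ring
    intro w hw
    have : W ≤ LinearMap.ker (innerₛₗ ℝ (y - (U.starProjection y + inner ℝ e y • e))) := by
      rw [hW, Submodule.span_le]
      rintro _ ⟨k, hk, rfl⟩
      simp only [SetLike.mem_coe, LinearMap.mem_ker, innerₛₗ_apply_apply]
      by_cases hkj : k = j
      · have : col X k = U.starProjection (col X j) + ‖η‖ • e := by
          rw [← hηe, hη, hkj]; abel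
        rw [this, inner_add_right, hsub _ (U.starProjection_apply_mem _), inner_smul_right, hsube]
        simp
      · exact hsub _ (Submodule.subset_span ⟨k, by simpa [hkj] using hk, rfl⟩)
    exact LinearMap.mem_ker.1 (this hw)
  have horth : inner ℝ (U.starProjection y) (inner ℝ e y • e) = 0 := by
    rw [inner_smul_right, real_inner_comm e, heU _ (U.starProjection_apply_mem _), mul_zero]
  have hsq : ‖inner ℝ e y • e‖ ^ 2 = inner ℝ e y ^ 2 := by
    rw [← real_inner_self_eq_norm_sq, inner_smul_left, inner_smul_right, hee, conj_trivial, sq]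
  change ‖W.starProjection y‖ ^ 2 - ‖U.starProjection y‖ ^ 2 = _
  rw [hproj, norm_add_sq_real, horth, hsq]
  ring

lemma localScore_singleton {n p : ℕ} (X : Matrix (Fin n) (Fin p) ℝ)
    (y : EuclideanSpace ℝ (Fin n)) (j : Fin p) :
    localScore X y j {j} = inner ℝ (‖col X j‖⁻¹ • col X j) y ^ 2 := by
  have h1 : proj X ({j} : Finset (Fin p)) y = (inner ℝ (col X j) y / ‖col X j‖ ^ 2) • col X j := by
    simp [proj, Submodule.starProjection_singleton]
  have h2 : proj X (({j} : Finset (Fin p)).erase j) y = 0 := by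
    simp [proj]
  rw [localScore, h1, h2, norm_smul, inner_smul_left]
  by_cases h : ‖col X j‖ = 0
  · simp [h]
  · simp only [Real.norm_eq_abs, mul_pow, sq_abs, conj_trivial, norm_zero]
    field_simp
    ring

/-- The factor `n` cancels the normalization to norm `√n`, and a zero column scores zero on both
sides. -/
lemma faMrScore_eq {n p : ℕ} (hn : 0 < n) {X : Matrix (Fin n) (Fin p) ℝ} (D : SVD X)
    (y : EuclideanSpace ℝ (Fin n)) (j : Fin p) :
    faMrScore D y j =
      localScore (D.adjMat D.numFactors) (D.adjVec D.numFactors y) j {j} := by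
  have hn' : (0 : ℝ) < n := by exact_mod_cast hn
  rw [localScore_singleton, faMrScore, marginalCoef]
  set x := col (D.adjMat D.numFactors) j
  set w := D.adjVec D.numFactors y
  rw [inner_smul_left, inner_smul_left, inner_smul_left, inner_smul_right,
    real_inner_self_eq_norm_sq]
  simp only [conj_trivial]
  by_cases h : ‖x‖ = 0
  · simp [h]
  · have hs : √(n : ℝ) ^ 2 = n := Real.sq_sqrt hn'.le
    rw [div_pow, sq_abs]
    field_simp
    rw [hs]

/-! ### Marginal scores never exceed the covariate-assisted ones -/

lemma bddAbove_localScore {n p : ℕ} (X : Matrix (Fin n) (Fin p) ℝ)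
    (y : EuclideanSpace ℝ (Fin n)) (j : Fin p) (s : Set (Finset (Fin p))) :
    BddAbove (localScore X y j '' s) :=
  (Set.toFinite _).bddAbove

lemma singleton_mem_neighborhoods {p m : ℕ} (𝒢 : SimpleGraph (Fin p)) (hm : 1 ≤ m) (j : Fin p) :
    {j} ∈ neighborhoods 𝒢 m j := by
  refine ⟨by simp, by simpa using hm, ?_⟩
  have : Subsingleton ((({j} : Finset (Fin p)) : Set (Fin p))) := by
    simp only [Finset.coe_singleton]; infer_instance
  have : Nonempty ((({j} : Finset (Fin p)) : Set (Fin p))) := ⟨⟨j, by simp⟩⟩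
  exact ⟨SimpleGraph.Preconnected.of_subsingleton⟩

lemma faMrScore_le_faCarScore {n p m : ℕ} (hn : 0 < n) (hm : 1 ≤ m)
    {X : Matrix (Fin n) (Fin p) ℝ} (D : SVD X) (δ : ℝ) (y : EuclideanSpace ℝ (Fin n))
    (j : Fin p) : faMrScore D y j ≤ faCarScore D m δ y j := by
  rw [faMrScore_eq hn]
  exact le_csSup (bddAbove_localScore _ _ _ _) ⟨_, singleton_mem_neighborhoods _ hm j, rfl⟩

lemma exists_lt_localScore_of_lt_faCarScore {n p m : ℕ} {X : Matrix (Fin n) (Fin p) ℝ}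
    (D : SVD X) (δ : ℝ) (y : EuclideanSpace ℝ (Fin n)) (j : Fin p) {t : ℝ} (ht : 0 ≤ t)
    (h : t < faCarScore D m δ y j) :
    ∃ I ∈ neighborhoods (corrGraph (gram (D.adjMat D.numFactors)) δ) m j,
      t < localScore (D.adjMat D.numFactors) (D.adjVec D.numFactors y) j I := by
  by_contra! hI
  -- `0 ≤ t` covers an empty family of neighborhoods, whose `sSup` is `0`.
  refine h.not_ge (Real.sSup_le ?_ ht)
  rintro _ ⟨I, hI', rfl⟩
  exact hI I hI'

/-! ### Restricted eigenvalues and the bias of the local scores -/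

lemma quadForm_ge_of_submatrix_eigenvalues {p : ℕ} {G : Matrix (Fin p) (Fin p) ℝ}
    (hs : G.IsHermitian) {J : Finset (Fin p)} {c₀ : ℝ}
    (hJ : ∀ μ : ℝ, Module.End.HasEigenvalue
      (Matrix.toLin' (G.submatrix (Subtype.val : J → Fin p) (Subtype.val : J → Fin p))) μ → c₀ ≤ μ)
    (c : Fin p → ℝ) :
    c₀ * ∑ i ∈ J, c i ^ 2 ≤ ∑ i ∈ J, ∑ k ∈ J, c i * c k * G i k := by
  set A := G.submatrix (Subtype.val : J → Fin p) (Subtype.val : J → Fin p) with hA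
  have hAh : A.IsHermitian := hs.submatrix _
  have hBh : (A - c₀ • (1 : Matrix J J ℝ)).IsHermitian :=
    hAh.sub (Matrix.isHermitian_one.smul (by simp [IsSelfAdjoint]))
  have hpsd : (A - c₀ • (1 : Matrix J J ℝ)).PosSemidef := by
    rw [hBh.posSemidef_iff_eigenvalues_nonneg]
    intro i
    have h1 := hBh.mulVec_eigenvectorBasis i
    have h2 : A.mulVec (hBh.eigenvectorBasis i).ofLp =
        (hBh.eigenvalues i + c₀) • (hBh.eigenvectorBasis i).ofLp := by
      rw [Matrix.sub_mulVec, Matrix.smul_mulVec, Matrix.one_mulVec] at h1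
      rw [add_smul, ← h1]; abel
    have h3 := hJ (hBh.eigenvalues i + c₀) (by
      refine Module.End.hasEigenvalue_of_hasEigenvector
        (x := (hBh.eigenvectorBasis i).ofLp) ⟨?_, ?_⟩
      · rw [Module.End.mem_eigenspace_iff, Matrix.toLin'_apply, h2]
      · intro h0
        have := hBh.eigenvectorBasis.orthonormal.1 i
        rw [show hBh.eigenvectorBasis i = 0 from by ext k; simp [h0]] at this
        simp at this)
    simpa using h3
  have h := hpsd.dotProduct_mulVec_nonneg (fun i : J => c i)
  have e1 : ∑ i ∈ J, c i ^ 2 = ∑ i : J, c i ^ 2 := (Finset.sum_coe_sort J (fun i => c i ^ 2)).symm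
  have e2 : ∑ i ∈ J, ∑ k ∈ J, c i * c k * G i k = ∑ i : J, ∑ k : J, c i * c k * G i k := by
    rw [← Finset.sum_coe_sort J]
    exact Finset.sum_congr rfl fun i _ => (Finset.sum_coe_sort J (fun k => c i * c k * G i k)).symm
  rw [e1, e2]
  rw [Matrix.sub_mulVec, Matrix.smul_mulVec, Matrix.one_mulVec, dotProduct_sub, dotProduct_smul,
    sub_nonneg] at h
  simp only [dotProduct, Matrix.mulVec, star_trivial, smul_eq_mul, Finset.mul_sum] at h
  rw [Finset.mul_sum]
  calc _ = _ := Finset.sum_congr rfl fun i _ => by rw [sq]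
    _ ≤ _ := h
    _ = _ := Finset.sum_congr rfl fun i _ => Finset.sum_congr rfl fun k _ => by simp [hA]; ring

/-- The eigenvalue condition concerns sets of exactly `g` nodes; a smaller set is enlarged to one
and the coefficients are padded with zeros. -/
lemma quadForm_ge_of_sparseCov {p g : ℕ} {γ c₀ C₀ : ℝ} {G : Matrix (Fin p) (Fin p) ℝ}
    (hG : SparseCov g γ c₀ C₀ G) (hgp : g ≤ p) {I : Finset (Fin p)} (hI : I.card ≤ g)
    (c : Fin p → ℝ) :
    c₀ * ∑ i ∈ I, c i ^ 2 ≤ ∑ i ∈ I, ∑ k ∈ I, c i * c k * G i k := by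
  classical
  obtain ⟨J, hIJ, hJ⟩ := Finset.exists_superset_card_eq hI (by simpa using hgp)
  have h := quadForm_ge_of_submatrix_eigenvalues hG.1.1 (hG.2.1 J hJ)
    (fun i => if i ∈ I then c i else 0)
  have e : ∀ f : Fin p → ℝ, ∑ i ∈ J, (if i ∈ I then f i else 0) = ∑ i ∈ I, f i := by
    intro f
    rw [← Finset.sum_filter, Finset.filter_mem_eq_inter, Finset.inter_eq_right.2 hIJ]
  have e1 : ∑ i ∈ J, (if i ∈ I then c i else 0) ^ 2 = ∑ i ∈ I, c i ^ 2 := by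
    rw [← e]; exact Finset.sum_congr rfl fun i _ => by split_ifs <;> simp
  have e2 : ∑ i ∈ J, ∑ k ∈ J, (if i ∈ I then c i else 0) * (if k ∈ I then c k else 0) * G i k =
      ∑ i ∈ I, ∑ k ∈ I, c i * c k * G i k := by
    rw [← e]
    refine Finset.sum_congr rfl fun i _ => ?_
    split_ifs with hi
    · rw [← e]; exact Finset.sum_congr rfl fun k _ => by split_ifs <;> simp
    · simp
  rwa [e1, e2] at h

lemma quadForm_ge_of_abs_sub_le {p g : ℕ} {G H : Matrix (Fin p) (Fin p) ℝ} {c₀ ε : ℝ}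
    {I : Finset (Fin p)} (hI : I.card ≤ g) (hGH : ∀ i k, |H i k - G i k| ≤ ε)
    (hε0 : 0 ≤ ε) (hε : g * ε ≤ c₀ / 2) {c : Fin p → ℝ}
    (hG : c₀ * ∑ i ∈ I, c i ^ 2 ≤ ∑ i ∈ I, ∑ k ∈ I, c i * c k * G i k) :
    c₀ / 2 * ∑ i ∈ I, c i ^ 2 ≤ ∑ i ∈ I, ∑ k ∈ I, c i * c k * H i k := by
  have h1 : ∑ i ∈ I, ∑ k ∈ I, c i * c k * G i k - ∑ i ∈ I, ∑ k ∈ I, c i * c k * H i k ≤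
      ε * (∑ i ∈ I, |c i|) ^ 2 := by
    rw [← Finset.sum_sub_distrib, sq, Finset.sum_mul_sum, Finset.mul_sum]
    refine Finset.sum_le_sum fun i _ => ?_
    rw [← Finset.sum_sub_distrib, Finset.mul_sum]
    refine Finset.sum_le_sum fun k _ => ?_
    rw [← mul_sub]
    refine (le_abs_self _).trans ?_
    rw [abs_mul, abs_mul, abs_sub_comm, mul_comm]
    exact mul_le_mul_of_nonneg_right (hGH i k) (by positivity)
  have h2 : (∑ i ∈ I, |c i|) ^ 2 ≤ g * ∑ i ∈ I, c i ^ 2 := by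
    have := sq_sum_le_card_mul_sum_sq (s := I) (f := fun i => |c i|)
    simp only [sq_abs] at this
    refine this.trans ?_
    gcongr
  have h3 : 0 ≤ ∑ i ∈ I, c i ^ 2 := Finset.sum_nonneg fun _ _ => sq_nonneg _
  have h4 : ε * (∑ i ∈ I, |c i|) ^ 2 ≤ c₀ / 2 * ∑ i ∈ I, c i ^ 2 := by
    calc _ ≤ ε * (g * ∑ i ∈ I, c i ^ 2) := by gcongr
      _ = (g * ε) * ∑ i ∈ I, c i ^ 2 := by ring
      _ ≤ _ := by gcongr
  linarith

/-- Write `e = ∑ c_k x_k`. The restricted eigenvalue bound and `‖e‖ ≤ 1` force `|c_k| ≤ √(2/c₀)/√n`,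
while the signal has inner product at most `n t B` with each column in `I`. -/
lemma abs_inner_signal_le {n p g : ℕ} (hn : 0 < n) {X : Matrix (Fin n) (Fin p) ℝ} {c₀ : ℝ}
    (hc₀ : 0 < c₀) {I S : Finset (Fin p)} (hI : I.card ≤ g)
    (hH : ∀ c : Fin p → ℝ,
      c₀ / 2 * ∑ i ∈ I, c i ^ 2 ≤ ∑ i ∈ I, ∑ k ∈ I, c i * c k * gram X i k)
    {e : EuclideanSpace ℝ (Fin n)} (he : e ∈ Submodule.span ℝ (col X '' (I : Set (Fin p))))
    (he1 : ‖e‖ ≤ 1) {β : Fin p → ℝ} {t B : ℝ} (hB0 : 0 ≤ B) (hβ : ∀ i ∈ S, |β i| ≤ t)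
    (ht : 0 ≤ t) (hB : ∀ k ∈ I, ∑ i ∈ S, |gram X k i| ≤ B) :
    |inner ℝ e (∑ i ∈ S, β i • col X i)| ≤ g * (√(2 / c₀) * (√n * t) * B) := by
  have hn' : (0 : ℝ) < n := by exact_mod_cast hn
  obtain ⟨c, rfl⟩ := (Submodule.mem_span_image_finset_iff_exists_fun' ℝ).1 he
  have hgram : ∀ i k, inner ℝ (col X i) (col X k) = n * gram X i k := by
    intro i k; rw [gram_eq_inner]; field_simp
  have hnorm : ‖∑ i ∈ I, c i • col X i‖ ^ 2 = n * ∑ i ∈ I, ∑ k ∈ I, c i * c k * gram X i k := by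
    rw [← real_inner_self_eq_norm_sq, sum_inner, Finset.mul_sum]
    refine Finset.sum_congr rfl fun i _ => ?_
    rw [inner_sum, Finset.mul_sum]
    refine Finset.sum_congr rfl fun k _ => ?_
    rw [inner_smul_left, inner_smul_right, hgram, conj_trivial]; ring
  have hcs : ∑ i ∈ I, c i ^ 2 ≤ 2 / c₀ / n := by
    have h1 := hH c
    have h2 : ‖∑ i ∈ I, c i • col X i‖ ^ 2 ≤ 1 := by
      have := pow_le_pow_left₀ (norm_nonneg _) he1 2
      simpa using this
    rw [hnorm] at h2
    rw [div_div, le_div_iff₀ (by positivity)]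
    have h3 : n * (c₀ / 2 * ∑ i ∈ I, c i ^ 2) ≤ 1 := (mul_le_mul_of_nonneg_left h1 hn'.le).trans h2
    linarith
  have hck : ∀ k ∈ I, |c k| * √n ≤ √(2 / c₀) := by
    intro k hk
    rw [← Real.sqrt_sq_eq_abs, ← Real.sqrt_mul (sq_nonneg _)]
    apply Real.sqrt_le_sqrt
    have := Finset.single_le_sum (f := fun i => c i ^ 2) (fun i _ => sq_nonneg _) hk
    rw [← le_div_iff₀ hn']
    exact this.trans hcs
  have hexp : inner ℝ (∑ k ∈ I, c k • col X k) (∑ i ∈ S, β i • col X i) =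
      ∑ k ∈ I, ∑ i ∈ S, c k * β i * (n * gram X k i) := by
    rw [sum_inner]
    refine Finset.sum_congr rfl fun k _ => ?_
    rw [inner_sum]
    refine Finset.sum_congr rfl fun i _ => ?_
    rw [inner_smul_left, inner_smul_right, hgram, conj_trivial]; ring
  rw [hexp]
  calc |∑ k ∈ I, ∑ i ∈ S, c k * β i * (n * gram X k i)|
      ≤ ∑ k ∈ I, ∑ i ∈ S, |c k| * t * (n * |gram X k i|) := by
        refine (Finset.abs_sum_le_sum_abs _ _).trans (Finset.sum_le_sum fun k _ => ?_)
        refine (Finset.abs_sum_le_sum_abs _ _).trans (Finset.sum_le_sum fun i hi => ?_)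
        rw [abs_mul, abs_mul, abs_mul, Nat.abs_cast]
        gcongr
        exact hβ i hi
    _ = ∑ k ∈ I, (|c k| * √n) * (√n * t) * ∑ i ∈ S, |gram X k i| := by
        refine Finset.sum_congr rfl fun k _ => ?_
        rw [Finset.mul_sum]
        refine Finset.sum_congr rfl fun i _ => ?_
        conv_lhs => rw [← Real.mul_self_sqrt hn'.le]
        ring
    _ ≤ ∑ k ∈ I, √(2 / c₀) * (√n * t) * B := by
        refine Finset.sum_le_sum fun k hk => ?_
        gcongr
        · exact hck k hk
        · exact hB k hk
    _ = I.card * (√(2 / c₀) * (√n * t) * B) := by rw [Finset.sum_const, nsmul_eq_mul]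
    _ ≤ _ := by gcongr

/-! ### Counting connected neighborhoods -/

section Counting

open scoped Classical in
/-- The nodes at walking distance at most `t` from `i`. -/
def walkBall {V : Type*} [Fintype V] (𝒢 : SimpleGraph V) (t : ℕ) (i : V) : Finset V :=
  Finset.univ.filter fun k => ∃ w : 𝒢.Walk i k, w.length ≤ t

open scoped Classical in
/-- The nodes adjacent to `i`. -/
def adjSet {V : Type*} [Fintype V] (𝒢 : SimpleGraph V) (i : V) : Finset V :=
  Finset.univ.filter fun k => 𝒢.Adj i k

lemma card_walkBall_le {V : Type*} [Fintype V] {𝒢 : SimpleGraph V} {d : ℕ}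
    (hd : ∀ i, (adjSet 𝒢 i).card ≤ d) (t : ℕ) (i : V) : (walkBall 𝒢 t i).card ≤ (d + 1) ^ t := by
  classical
  induction t generalizing i with
  | zero =>
    rw [pow_zero, Finset.card_le_one]
    intro a ha b hb
    simp only [walkBall, Finset.mem_filter, Finset.mem_univ, true_and, nonpos_iff_eq_zero] at ha hb
    obtain ⟨w, hw⟩ := ha
    obtain ⟨w', hw'⟩ := hb
    rw [← SimpleGraph.Walk.eq_of_length_eq_zero hw, SimpleGraph.Walk.eq_of_length_eq_zero hw']
  | succ t ih =>
    have hsub : walkBall 𝒢 (t + 1) i ⊆ (insert i (adjSet 𝒢 i)).biUnion (walkBall 𝒢 t) := by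
      intro k hk
      simp only [walkBall, Finset.mem_filter, Finset.mem_univ, true_and] at hk
      obtain ⟨w, hw⟩ := hk
      rw [Finset.mem_biUnion]
      cases w with
      | nil => exact ⟨i, by simp, by simpa [walkBall] using ⟨.nil, by simp⟩⟩
      | cons h w' =>
        refine ⟨_, Finset.mem_insert_of_mem (by simpa [adjSet] using h), ?_⟩
        simp only [walkBall, Finset.mem_filter, Finset.mem_univ, true_and]
        exact ⟨w', by simpa using hw⟩
    calc _ ≤ _ := Finset.card_le_card hsub
      _ ≤ (insert i (adjSet 𝒢 i)).card * (d + 1) ^ t :=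
        Finset.card_biUnion_le_card_mul _ _ _ fun l _ => ih l
      _ ≤ (d + 1) * (d + 1) ^ t :=
        Nat.mul_le_mul_right _ ((Finset.card_insert_le _ _).trans (Nat.succ_le_succ (hd i)))
      _ = _ := by ring

variable {p : ℕ} {𝒢 : SimpleGraph (Fin p)} {m : ℕ}

/-- A path inside `I` does not repeat nodes, so its length is less than `|I| ≤ m`. The strict
inequality leaves room for one more edge in `card_nearSet_le`. -/
lemma exists_walk_of_mem_neighborhoods {j k : Fin p} {I : Finset (Fin p)}
    (hI : I ∈ neighborhoods 𝒢 m j) (hk : k ∈ I) : ∃ w : 𝒢.Walk j k, w.length < m := by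
  classical
  obtain ⟨hj, hcard, hconn⟩ := hI
  obtain ⟨w⟩ := hconn.preconnected ⟨j, hj⟩ ⟨k, hk⟩
  have hlt := w.toPath.2.length_lt
  have hlen := SimpleGraph.Walk.length_map
    (SimpleGraph.Embedding.induce (G := 𝒢) (I : Set (Fin p))).toHom w.toPath.1
  have : Fintype.card (I : Set (Fin p)) = I.card := by simp
  exact ⟨w.toPath.1.map (SimpleGraph.Embedding.induce (G := 𝒢) (I : Set (Fin p))).toHom,
    hlen.trans_lt (by omega)⟩

lemma neighborhoods_finite (𝒢 : SimpleGraph (Fin p)) (m : ℕ) (j : Fin p) :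
    (neighborhoods 𝒢 m j).Finite := Set.toFinite _

/-- A neighborhood is the image of a map from `Fin m` into the ball of radius `m` about `j`. The
bound is crude but polylogarithmic when `d` is. -/
lemma card_neighborhoods_le {d : ℕ} (hd : ∀ i, (adjSet 𝒢 i).card ≤ d) (j : Fin p) :
    (neighborhoods_finite 𝒢 m j).toFinset.card ≤ ((d + 1) ^ m) ^ m := by
  classical
  have hsub : (neighborhoods_finite 𝒢 m j).toFinset ⊆
      (Finset.univ : Finset (Fin m → walkBall 𝒢 m j)).image
        (fun f => Finset.univ.image fun a => (f a : Fin p)) := by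
    intro I hI
    rw [Set.Finite.mem_toFinset] at hI
    have : Nonempty I := ⟨⟨j, hI.1⟩⟩
    obtain ⟨f⟩ : Nonempty (I ↪ Fin m) :=
      Function.Embedding.nonempty_of_card_le (by simpa using hI.2.1)
    set q : Fin m → I := Function.invFun f
    have hsurj : Function.Surjective q := Function.invFun_surjective f.injective
    rw [Finset.mem_image]
    refine ⟨fun a => ⟨q a, ?_⟩, Finset.mem_univ _, ?_⟩
    · obtain ⟨w, hw⟩ := exists_walk_of_mem_neighborhoods hI (q a).2
      simp only [walkBall, Finset.mem_filter, Finset.mem_univ, true_and]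
      exact ⟨w, hw.le⟩
    · ext k
      simp only [Finset.mem_image, Finset.mem_univ, true_and]
      constructor
      · rintro ⟨a, rfl⟩; exact (q a).2
      · intro hk
        obtain ⟨a, ha⟩ := hsurj ⟨k, hk⟩
        exact ⟨a, by rw [ha]⟩
  calc _ ≤ _ := Finset.card_le_card hsub
    _ ≤ _ := Finset.card_image_le
    _ = (walkBall 𝒢 m j).card ^ m := by simp
    _ ≤ _ := Nat.pow_le_pow_left (card_walkBall_le hd m j) m

open scoped Classical in
/-- The nodes one of whose neighborhoods meets `S` or is adjacent to a node of `S`. -/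
def nearSet (𝒢 : SimpleGraph (Fin p)) (m : ℕ) (S : Finset (Fin p)) : Finset (Fin p) :=
  Finset.univ.filter fun j => ∃ I ∈ neighborhoods 𝒢 m j, ∃ k ∈ I, ∃ i ∈ S, k = i ∨ 𝒢.Adj i k

/-- Reversing the walk from `j` shows that `j` lies in the ball of radius `m` about a node of `S`.
-/
lemma card_nearSet_le {d : ℕ} (hd : ∀ i, (adjSet 𝒢 i).card ≤ d) (S : Finset (Fin p)) :
    (nearSet 𝒢 m S).card ≤ S.card * (d + 1) ^ m := by
  classical
  have hsub : nearSet 𝒢 m S ⊆ S.biUnion (walkBall 𝒢 m) := by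
    intro j hj
    simp only [nearSet, Finset.mem_filter, Finset.mem_univ, true_and] at hj
    obtain ⟨I, hI, k, hk, i, hi, h⟩ := hj
    obtain ⟨w, hw⟩ := exists_walk_of_mem_neighborhoods hI hk
    rw [Finset.mem_biUnion]
    refine ⟨i, hi, ?_⟩
    simp only [walkBall, Finset.mem_filter, Finset.mem_univ, true_and]
    rcases h with rfl | h
    · exact ⟨w.reverse, by simpa using hw.le⟩
    · exact ⟨.cons h w.reverse, by simpa using hw⟩
  exact (Finset.card_le_card hsub).trans
    (Finset.card_biUnion_le_card_mul _ _ _ fun i _ => card_walkBall_le hd m i)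

end Counting

/-! ### Sparsity of the adjusted Gram matrix -/

section Sparsity

variable {p : ℕ} {G H : Matrix (Fin p) (Fin p) ℝ} {γ C₀ ε δ : ℝ}

lemma adj_corrGraph_iff (hs : ∀ i j, H i j = H j i) {i j : Fin p} :
    (corrGraph H δ).Adj i j ↔ i ≠ j ∧ δ < |H i j| / √(H i i * H j j) := by
  rw [corrGraph, SimpleGraph.fromRel_adj, hs j i, mul_comm (H j j), or_self]

/-- An edge forces `|H i j| > δh`, hence `|G i j| ≥ u = δh/2`. As `u ≤ 1`, each neighbor contributes
at least `u^γ ≥ u` to the row sum, which is at most `C₀`. -/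
lemma card_adjSet_corrGraph_le (hs : ∀ i j, H i j = H j i) {h : ℝ} (hh : 0 < h)
    (hH : ∀ i, h ≤ H i i) (hGH : ∀ i j, |H i j - G i j| ≤ ε) (hδ : 0 < δ) (hε : ε ≤ δ * h / 2)
    (hu : δ * h / 2 ≤ 1) (hγ0 : 0 < γ) (hγ1 : γ < 1) (hrow : ∀ i, ∑ j, |G i j| ^ γ ≤ C₀)
    (i : Fin p) : ((adjSet (corrGraph H δ) i).card : ℝ) ≤ C₀ / (δ * h / 2) := by
  set u := δ * h / 2 with hudef
  have hu0 : 0 < u := by positivity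
  rw [le_div_iff₀ hu0]
  have hmem : ∀ j ∈ adjSet (corrGraph H δ) i, u ≤ |G i j| ^ γ := by
    intro j hj
    simp only [adjSet, Finset.mem_filter, Finset.mem_univ, true_and] at hj
    have hlt := ((adj_corrGraph_iff hs).1 hj).2
    have hsq : h ≤ √(H i i * H j j) := by
      apply Real.le_sqrt_of_sq_le
      rw [sq]
      exact mul_le_mul (hH i) (hH j) hh.le (hh.le.trans (hH i))
    have h1 : δ * h < |H i j| := by
      rw [lt_div_iff₀ (hh.trans_le hsq)] at hlt
      exact (mul_le_mul_of_nonneg_left hsq hδ.le).trans_lt hlt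
    have h2 : |H i j| ≤ |G i j| + ε := by
      have := abs_add_le (H i j - G i j) (G i j)
      rw [sub_add_cancel] at this
      linarith [hGH i j]
    have h3 : u ≤ |G i j| := by
      have : δ * h = 2 * u := by rw [hudef]; ring
      linarith
    calc u = u ^ (1 : ℝ) := (Real.rpow_one u).symm
      _ ≤ u ^ γ := Real.rpow_le_rpow_of_exponent_ge hu0 hu hγ1.le
      _ ≤ _ := Real.rpow_le_rpow hu0.le h3 hγ0.le
  calc ((adjSet (corrGraph H δ) i).card : ℝ) * u = ∑ _j ∈ adjSet (corrGraph H δ) i, u := by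
        rw [Finset.sum_const, nsmul_eq_mul]
    _ ≤ ∑ j ∈ adjSet (corrGraph H δ) i, |G i j| ^ γ := Finset.sum_le_sum hmem
    _ ≤ ∑ j, |G i j| ^ γ :=
        Finset.sum_le_univ_sum_of_nonneg fun j => Real.rpow_nonneg (abs_nonneg _) _
    _ ≤ C₀ := hrow i

/-- Without an edge `|H k i| ≤ δ`, because the diagonal is at most one; so `|G k i| ≤ δ + ε`. The
splitting `|G| = |G|^γ |G|^(1-γ)` then turns the `γ`-row sum into a small `ℓ¹` sum, and passing from
`G` to `H` costs `ε` per element of `S`. -/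
lemma sum_abs_le_of_not_adj (hs : ∀ i j, H i j = H j i) (hH0 : ∀ i, 0 < H i i)
    (hH1 : ∀ i, H i i ≤ 1) (hGH : ∀ i j, |H i j - G i j| ≤ ε) (hδ : 0 ≤ δ)
    (hγ1 : γ < 1) (hrow : ∀ i, ∑ j, |G i j| ^ γ ≤ C₀)
    {S : Finset (Fin p)} {k : Fin p} (hkS : ∀ i ∈ S, ¬ (k = i ∨ (corrGraph H δ).Adj i k)) :
    ∑ i ∈ S, |H k i| ≤ S.card * ε + C₀ * (δ + ε) ^ (1 - γ) := by
  have hε : 0 ≤ ε := (abs_nonneg _).trans (hGH k k)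
  have hterm : ∀ i ∈ S, |H k i| ≤ ε + |G k i| ^ γ * (δ + ε) ^ (1 - γ) := by
    intro i hi
    have hna := hkS i hi
    rw [not_or, SimpleGraph.adj_comm, adj_corrGraph_iff hs, not_and, not_lt] at hna
    have h1 := hna.2 hna.1
    have hpos : 0 < √(H k k * H i i) := Real.sqrt_pos.2 (mul_pos (hH0 k) (hH0 i))
    rw [div_le_iff₀ hpos] at h1
    have h2 : √(H k k * H i i) ≤ 1 := by
      refine Real.sqrt_le_iff.2 ⟨zero_le_one, ?_⟩
      rw [one_pow]
      exact mul_le_one₀ (hH1 k) (hH0 i).le (hH1 i)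
    have h3 : |H k i| ≤ δ := h1.trans (mul_le_of_le_one_right hδ h2)
    have h4 := hGH k i
    have h5 : |H k i| ≤ |G k i| + ε := by
      have := abs_add_le (H k i - G k i) (G k i)
      rw [sub_add_cancel] at this
      linarith
    have h6 : |G k i| ≤ δ + ε := by
      have := abs_add_le (G k i - H k i) (H k i)
      rw [sub_add_cancel, abs_sub_comm] at this
      linarith
    have h7 : |G k i| ≤ |G k i| ^ γ * (δ + ε) ^ (1 - γ) := by
      rcases (abs_nonneg (G k i)).eq_or_lt with h0 | h0
      · rw [← h0]; positivity
      · calc |G k i| = |G k i| ^ γ * |G k i| ^ (1 - γ) := by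
              rw [← Real.rpow_add h0]; simp
          _ ≤ _ := by
              gcongr
    linarith
  calc ∑ i ∈ S, |H k i| ≤ ∑ i ∈ S, (ε + |G k i| ^ γ * (δ + ε) ^ (1 - γ)) := Finset.sum_le_sum hterm
    _ = S.card * ε + (∑ i ∈ S, |G k i| ^ γ) * (δ + ε) ^ (1 - γ) := by
        rw [Finset.sum_add_distrib, Finset.sum_const, nsmul_eq_mul, Finset.sum_mul]
    _ ≤ _ := by
        gcongr
        exact (Finset.sum_le_univ_sum_of_nonneg fun j =>
          Real.rpow_nonneg (abs_nonneg _) _).trans (hrow k)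

end Sparsity

/-! ### False positives at a fixed dimension -/

section FixedDimension

variable {n p : ℕ} {X : Matrix (Fin n) (Fin p) ℝ}

lemma continuous_response (X : Matrix (Fin n) (Fin p) ℝ) (β : Fin p → ℝ) :
    Continuous (response X β) := by
  unfold response; fun_prop

lemma response_adjusted (D : SVD X) (N : ℕ) (β : Fin p → ℝ) {e : EuclideanSpace ℝ (Fin n)}
    {I : Set (Fin p)} (he : e ∈ Submodule.span ℝ (col (D.adjMat N) '' I))
    (z : EuclideanSpace ℝ (Fin n)) :
    inner ℝ e (D.adjVec N (response X β z)) =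
      inner ℝ e (∑ i ∈ supp β, β i • col (D.adjMat N) i) + inner ℝ e z := by
  have he' : e ∈ Submodule.span ℝ (Set.range (col (D.adjMat N))) :=
    Submodule.span_mono (Set.image_subset_range _ _) he
  rw [D.adjVec_response, inner_add_right, D.inner_adjVec_of_mem_span N he']
  congr 2
  rw [supp, Finset.sum_filter_of_ne]
  intro i _ h h0
  simp [h0] at h

lemma isOpen_lt_localScore (D : SVD X) (N : ℕ) (β : Fin p → ℝ) {j : Fin p}
    {I : Finset (Fin p)} (hj : j ∈ I) (t : ℝ) :
    IsOpen {z | t < localScore (D.adjMat N) (D.adjVec N (response X β z)) j I} := by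
  obtain ⟨e, -, -, he⟩ := exists_localScore_eq_sq (D.adjMat N) hj
  simp only [he]
  refine isOpen_lt continuous_const (Continuous.pow ?_ 2)
  exact continuous_const.inner ((D.continuous_adjVec N).comp (continuous_response X β))

lemma setOf_lt_faCarScore_eq (D : SVD X) (m : ℕ) (δ : ℝ) (β : Fin p → ℝ) (j : Fin p) {t : ℝ}
    (ht : 0 ≤ t) :
    {z | t < faCarScore D m δ (response X β z) j} =
      ⋃ I ∈ (neighborhoods_finite (corrGraph (gram (D.adjMat D.numFactors)) δ) m j).toFinset,
        {z | t < localScore (D.adjMat D.numFactors)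
          (D.adjVec D.numFactors (response X β z)) j I} := by
  ext z
  simp only [Set.mem_ofPred_eq, Set.mem_iUnion, Set.Finite.mem_toFinset, exists_prop]
  constructor
  · exact exists_lt_localScore_of_lt_faCarScore D δ _ j ht
  · rintro ⟨I, hI, h⟩
    exact h.trans_le (le_csSup (bddAbove_localScore _ _ _ _) ⟨I, hI, rfl⟩)

lemma measurableSet_lt_faCarScore (D : SVD X) (m : ℕ) (δ : ℝ) (β : Fin p → ℝ) (j : Fin p) {t : ℝ}
    (ht : 0 ≤ t) : MeasurableSet {z | t < faCarScore D m δ (response X β z) j} := by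
  rw [setOf_lt_faCarScore_eq D m δ β j ht]
  refine Finset.measurableSet_biUnion _ fun I hI => ?_
  rw [Set.Finite.mem_toFinset] at hI
  exact (isOpen_lt_localScore D _ β hI.1 t).measurableSet

lemma measurableSet_lt_faMrScore (hn : 0 < n) (D : SVD X) (β : Fin p → ℝ) (j : Fin p) (t : ℝ) :
    MeasurableSet {z | t < faMrScore D (response X β z) j} := by
  simp only [faMrScore_eq hn]
  exact (isOpen_lt_localScore D _ β (Finset.mem_singleton_self j) t).measurableSet

lemma expFalse_eq_sum (β : Fin p → ℝ) (σ : ℝ) (T : EuclideanSpace ℝ (Fin n) → Fin p → ℝ) (q : ℝ)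
    (hT : ∀ j, MeasurableSet {z | 2 * q * σ ^ 2 * Real.log p < T (response X β z) j}) :
    expFalse X β σ T q = ∑ j ∈ (supp β)ᶜ,
      noiseLaw n σ {z | 2 * q * σ ^ 2 * Real.log p < T (response X β z) j} := by
  classical
  have h : ∀ z, ((retained σ q (T (response X β z)) \ supp β).card : ℝ≥0∞) =
      ∑ j ∈ (supp β)ᶜ, Set.indicator
        {z | 2 * q * σ ^ 2 * Real.log p < T (response X β z) j} (fun _ => (1 : ℝ≥0∞)) z := by
    intro z
    rw [Finset.sdiff_eq_inter_compl, Finset.inter_comm, ← Finset.filter_mem_eq_inter,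
      Finset.card_filter, Nat.cast_sum]
    refine Finset.sum_congr rfl fun j _ => ?_
    simp [retained, Set.indicator_apply]
  rw [expFalse]
  simp only [h]
  rw [lintegral_finsetSum _ fun j _ => measurable_const.indicator (hT j)]
  refine Finset.sum_congr rfl fun j _ => ?_
  rw [lintegral_indicator (hT j), setLIntegral_one]

variable {σ : ℝ} {β : Fin p → ℝ} {D : SVD X} {m : ℕ} {δ x ρ : ℝ}

/-- A union bound over the neighborhoods is set against the lower tail of the marginal score. The
factors `exp(-x²/2)` cancel, and `40 = 2 · 20`. Only the upper bound needs control of the means. -/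
lemma noiseLaw_lt_faCarScore_le (hσ : 0 < σ) (hx : 0 < x) (hρ : 0 ≤ ρ) {M : ℕ} (j : Fin p)
    (hcol : col (D.adjMat D.numFactors) j ≠ 0) (hn : 0 < n)
    (hM : (neighborhoods_finite (corrGraph (gram (D.adjMat D.numFactors)) δ) m j).toFinset.card
      ≤ M)
    (hbias : ∀ I ∈ neighborhoods (corrGraph (gram (D.adjMat D.numFactors)) δ) m j,
      ∀ e ∈ Submodule.span ℝ (col (D.adjMat D.numFactors) '' (I : Set (Fin p))), ‖e‖ = 1 →
        |inner ℝ e (∑ i ∈ supp β, β i • col (D.adjMat D.numFactors) i)| ≤ σ * ρ) :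
    noiseLaw n σ {z | σ ^ 2 * x ^ 2 < faCarScore D m δ (response X β z) j} ≤
      ENNReal.ofReal (M * (40 * (1 + x) * Real.exp (ρ * x))) *
        noiseLaw n σ {z | σ ^ 2 * x ^ 2 < faMrScore D (response X β z) j} := by
  have ht : 0 ≤ σ ^ 2 * x ^ 2 := by positivity
  have htpos : 0 < σ ^ 2 * x ^ 2 := by positivity
  have hup : ∀ I ∈ (neighborhoods_finite
      (corrGraph (gram (D.adjMat D.numFactors)) δ) m j).toFinset,
      noiseLaw n σ {z | σ ^ 2 * x ^ 2 < localScore (D.adjMat D.numFactors)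
          (D.adjVec D.numFactors (response X β z)) j I} ≤
        ENNReal.ofReal (2 * Real.exp (-(x ^ 2) / 2) * Real.exp (ρ * x)) := by
    intro I hI
    rw [Set.Finite.mem_toFinset] at hI
    obtain ⟨e, heI, he01, he⟩ := exists_localScore_eq_sq (D.adjMat D.numFactors) hI.1
    -- A degenerate direction has score zero and never passes the positive threshold.
    rcases he01 with h0 | h1
    · have : {z | σ ^ 2 * x ^ 2 < localScore (D.adjMat D.numFactors)
          (D.adjVec D.numFactors (response X β z)) j I} = ∅ := by
        ext z
        simp [he, h0, htpos.le]
      rw [this, measure_empty]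
      exact zero_le
    · simp only [he, response_adjusted D D.numFactors β heI]
      exact noiseLaw_lt_add_inner_sq_le hσ h1 hx.le hρ (hbias I hI e heI h1)
  have hlow : ENNReal.ofReal (Real.exp (-(x ^ 2) / 2) / (20 * (1 + x))) ≤
      noiseLaw n σ {z | σ ^ 2 * x ^ 2 < faMrScore D (response X β z) j} := by
    simp only [faMrScore_eq hn, localScore_singleton]
    have he : ‖col (D.adjMat D.numFactors) j‖⁻¹ • col (D.adjMat D.numFactors) j ∈
        Submodule.span ℝ (col (D.adjMat D.numFactors) '' {j}) :=
      Submodule.smul_mem _ _ (Submodule.subset_span ⟨j, rfl, rfl⟩)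
    simp only [response_adjusted D D.numFactors β he]
    refine le_noiseLaw_lt_add_inner_sq hσ ?_ hx.le _
    rw [norm_smul, norm_inv, norm_norm, inv_mul_cancel₀ (norm_ne_zero_iff.2 hcol)]
  rw [setOf_lt_faCarScore_eq D m δ β j ht]
  calc _ ≤ _ := measure_biUnion_finset_le _ _
    _ ≤ ∑ _I ∈ (neighborhoods_finite
          (corrGraph (gram (D.adjMat D.numFactors)) δ) m j).toFinset,
        ENNReal.ofReal (2 * Real.exp (-(x ^ 2) / 2) * Real.exp (ρ * x)) := Finset.sum_le_sum hup
    _ ≤ (M : ℝ≥0∞) * ENNReal.ofReal (2 * Real.exp (-(x ^ 2) / 2) * Real.exp (ρ * x)) := by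
        rw [Finset.sum_const, nsmul_eq_mul]
        gcongr
    _ = ENNReal.ofReal (M * (40 * (1 + x) * Real.exp (ρ * x))) *
          ENNReal.ofReal (Real.exp (-(x ^ 2) / 2) / (20 * (1 + x))) := by
        rw [← ENNReal.ofReal_natCast, ← ENNReal.ofReal_mul (by positivity),
          ← ENNReal.ofReal_mul (by positivity)]
        congr 1
        field_simp
        ring
    _ ≤ _ := by gcongr

/-- At a fixed dimension, the false positives of FA-CAR are those close to the support and
a multiple of those of FA-MR. -/
theorem expFalse_faCarScore_le (hn : 0 < n) (hp : 1 ≤ Real.log p) (hσ : 0 < σ)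
    {g d : ℕ} {γ c₀ C₀ a r ε η q : ℝ} {G : Matrix (Fin p) (Fin p) ℝ}
    (hγ0 : 0 < γ) (hγ1 : γ < 1) (hc₀ : 0 < c₀) (ha : 0 ≤ a)
    (hdiag : ∀ j, gram X j j = 1) (hG : SparseCov g γ c₀ C₀ G)
    (hGH : ∀ i j, |gram (D.adjMat D.numFactors) i j - G i j| ≤ ε)
    (hg : 1 ≤ g) (hgp : g ≤ p) (hm : m ≤ g)
    (hβ : ∀ j ∈ supp β, |β j| ≤ a * signalStrength n p σ r)
    (hε1 : g * ε ≤ c₀ / 2) (hε2 : ε ≤ δ * (c₀ / 2) / 2) (hδ : 0 < δ)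
    (hδ1 : δ * (c₀ / 2) / 2 ≤ 1) (hη : (supp β).card * ε + C₀ * (δ + ε) ^ (1 - γ) ≤ η)
    (hd : C₀ / (δ * (c₀ / 2) / 2) ≤ d) (hq : 0 < q) :
    expFalse X β σ (faCarScore D m δ) q ≤
      ENNReal.ofReal ((supp β).card * (d + 1 : ℝ) ^ m) +
      ENNReal.ofReal (((d + 1 : ℝ) ^ m) ^ m * (40 * (1 + √(2 * q * Real.log p)) *
        Real.exp (g * (√(2 / c₀) * (a * √(2 * r * Real.log p)) * η) * √(2 * q * Real.log p)))) *
        expFalse X β σ (faMrScore D) q := by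
  classical
  set H := gram (D.adjMat D.numFactors) with hH
  have hn' : (0 : ℝ) < n := by exact_mod_cast hn
  have hs : ∀ i j, H i j = H j i := fun i j => by
    rw [hH, gram_eq_inner, gram_eq_inner, real_inner_comm]
  have p0 : 0 < p := hg.trans hgp
  have hε0 : 0 ≤ ε := (abs_nonneg _).trans (hGH ⟨0, p0⟩ ⟨0, p0⟩)
  have hquad : ∀ I : Finset (Fin p), I.card ≤ g → ∀ c : Fin p → ℝ,
      c₀ / 2 * ∑ i ∈ I, c i ^ 2 ≤ ∑ i ∈ I, ∑ k ∈ I, c i * c k * H i k := fun I hI c =>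
    quadForm_ge_of_abs_sub_le hI hGH hε0 hε1 (quadForm_ge_of_sparseCov hG hgp hI c)
  have hH0 : ∀ i, c₀ / 2 ≤ H i i := fun i => by
    simpa using hquad {i} (by simpa using hg) (fun _ => 1)
  have hHpos : ∀ i, 0 < H i i := fun i => (half_pos hc₀).trans_le (hH0 i)
  have hH1 : ∀ i, H i i ≤ 1 := fun i => by
    rw [← hdiag i, hH, gram_self_eq, gram_self_eq]
    gcongr
    exact D.norm_col_adjMat_le _ i
  have hC₀ : 0 ≤ C₀ := (Finset.sum_nonneg fun j _ =>
    Real.rpow_nonneg (abs_nonneg _) _).trans (hG.2.2 ⟨0, p0⟩)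
  have hη0 : 0 ≤ η := le_trans (by positivity) hη
  have hdeg : ∀ i, (adjSet (corrGraph H δ) i).card ≤ d := fun i => by
    have := (card_adjSet_corrGraph_le hs (half_pos hc₀) hH0 hGH hδ hε2 hδ1 hγ0 hγ1 hG.2.2 i).trans hd
    exact_mod_cast this
  set x := √(2 * q * Real.log p) with hx
  set ρ := g * (√(2 / c₀) * (a * √(2 * r * Real.log p)) * η) with hρ
  have hx0 : 0 < x := Real.sqrt_pos.2 (by positivity)
  have hρ0 : 0 ≤ ρ := by positivity
  have ht : 2 * q * σ ^ 2 * Real.log p = σ ^ 2 * x ^ 2 := by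
    rw [hx, Real.sq_sqrt (by positivity)]; ring
  have ht0 : 0 ≤ σ ^ 2 * x ^ 2 := by positivity
  have hsig : √(n : ℝ) * (a * signalStrength n p σ r) = σ * (a * √(2 * r * Real.log p)) := by
    have : √(n : ℝ) ≠ 0 := (Real.sqrt_pos.2 hn').ne'
    rw [signalStrength]
    field_simp
  have hsig0 : 0 ≤ a * signalStrength n p σ r := by
    rw [signalStrength]; positivity
  have hgood : ∀ j ∉ nearSet (corrGraph H δ) m (supp β),
      noiseLaw n σ {z | σ ^ 2 * x ^ 2 < faCarScore D m δ (response X β z) j} ≤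
      ENNReal.ofReal (((d + 1 : ℝ) ^ m) ^ m * (40 * (1 + x) * Real.exp (ρ * x))) *
        noiseLaw n σ {z | σ ^ 2 * x ^ 2 < faMrScore D (response X β z) j} := by
    intro j hj
    have hcol : col (D.adjMat D.numFactors) j ≠ 0 := by
      intro h0
      have := hHpos j
      rw [hH, gram_self_eq, h0] at this
      simp at this
    have := noiseLaw_lt_faCarScore_le (β := β) (D := D) (m := m) (δ := δ) hσ hx0 hρ0
      (M := ((d + 1) ^ m) ^ m) j hcol hn (card_neighborhoods_le hdeg j) (by
        intro I hI e he he1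
        have hfar : ∀ k ∈ I, ∀ i ∈ supp β, ¬ (k = i ∨ (corrGraph H δ).Adj i k) := by
          intro k hk i hi h
          apply hj
          simp only [nearSet, Finset.mem_filter, Finset.mem_univ, true_and]
          exact ⟨I, hI, k, hk, i, hi, h⟩
        have hb := abs_inner_signal_le (S := supp β) hn hc₀ (hI.2.1.trans hm)
          (hquad I (hI.2.1.trans hm)) he he1.le hη0 hβ hsig0
          (fun k hk => (sum_abs_le_of_not_adj hs hHpos hH1 hGH hδ.le hγ1 hG.2.2
            (hfar k hk)).trans hη)
        rw [hsig] at hb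
        refine hb.trans (le_of_eq ?_)
        rw [hρ]; ring)
    simpa using this
  rw [expFalse_eq_sum β σ _ q (fun j => by
      rw [ht]; exact measurableSet_lt_faCarScore D m δ β j ht0),
    expFalse_eq_sum β σ _ q (fun j => measurableSet_lt_faMrScore hn D β j _), ht]
  set R := ENNReal.ofReal (((d + 1 : ℝ) ^ m) ^ m * (40 * (1 + x) * Real.exp (ρ * x))) with hR
  have hnear : ((nearSet (corrGraph H δ) m (supp β)).card : ℝ≥0∞) ≤
      ENNReal.ofReal ((supp β).card * (d + 1 : ℝ) ^ m) := by
    rw [← ENNReal.ofReal_natCast]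
    apply ENNReal.ofReal_le_ofReal
    exact_mod_cast card_nearSet_le hdeg (supp β)
  -- Nodes near the support get the trivial bound one; only their number matters.
  calc ∑ j ∈ (supp β)ᶜ, noiseLaw n σ {z | σ ^ 2 * x ^ 2 < faCarScore D m δ (response X β z) j}
      ≤ ∑ j ∈ (supp β)ᶜ, ((if j ∈ nearSet (corrGraph H δ) m (supp β) then 1 else 0) +
          R * noiseLaw n σ {z | σ ^ 2 * x ^ 2 < faMrScore D (response X β z) j}) := by
        refine Finset.sum_le_sum fun j _ => ?_
        split_ifs with h
        · exact prob_le_one.trans le_self_add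
        · rw [zero_add]; exact hgood j h
    _ = ∑ j ∈ (supp β)ᶜ, (if j ∈ nearSet (corrGraph H δ) m (supp β) then 1 else 0) +
          R * ∑ j ∈ (supp β)ᶜ,
            noiseLaw n σ {z | σ ^ 2 * x ^ 2 < faMrScore D (response X β z) j} := by
        rw [Finset.sum_add_distrib, Finset.mul_sum]
    _ ≤ _ := by
        gcongr
        refine le_trans ?_ hnear
        rw [← Finset.sum_filter, Finset.sum_const, nsmul_eq_mul, mul_one]
        gcongr
        intro j hj
        exact (Finset.mem_filter.1 hj).2

end FixedDimension

/-! ### Multi-logarithmic sequences -/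

lemma tendsto_log_natCast : Tendsto (fun p : ℕ => Real.log p) atTop atTop :=
  Real.tendsto_log_atTop.comp tendsto_natCast_atTop_atTop

lemma eventually_mul_log_pow_le (A : ℝ) (k : ℕ) {κ : ℝ} (hκ : 0 < κ) :
    ∀ᶠ p : ℕ in atTop, A * Real.log p ^ k ≤ Real.exp (κ * Real.log p) := by
  have h := (isLittleO_pow_exp_pos_mul_atTop k hκ).const_mul_left A
  have h1 := h.bound zero_lt_one
  filter_upwards [tendsto_log_natCast.eventually h1] with p hp
  rw [one_mul, Real.norm_of_nonneg (Real.exp_pos _).le] at hp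
  exact (le_abs_self _).trans hp

/-- If a property holds eventually for each positive rate, then it holds eventually along some
rate that tends to zero. -/
lemma exists_tendsto_zero_of_forall_eventually {P : ℝ → ℕ → Prop}
    (h : ∀ κ : ℝ, 0 < κ → ∀ᶠ p in atTop, P κ p) :
    ∃ κ : ℕ → ℝ, (∀ p, 0 < κ p) ∧ Tendsto κ atTop (𝓝 0) ∧ ∀ᶠ p in atTop, P (κ p) p := by
  have h' : ∀ k : ℕ, ∃ N, ∀ p ≥ N, P (1 / ((k : ℝ) + 1)) p := fun k =>
    eventually_atTop.1 (h _ Nat.one_div_pos_of_nat)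
  choose N hN using h'
  -- The rate at `p` is `1/(k+1)` for the largest `k ≤ p` whose starting point `N k` has been
  -- reached.
  set k : ℕ → ℕ := fun p => Nat.findGreatest (fun k => N k ≤ p) p with hk
  have hk_top : Tendsto k atTop atTop := by
    rw [tendsto_atTop]
    intro b
    filter_upwards [eventually_ge_atTop b, eventually_ge_atTop (N b)] with p h1 h2
    exact Nat.le_findGreatest h1 h2
  refine ⟨fun p => 1 / ((k p : ℝ) + 1), fun p => Nat.one_div_pos_of_nat,
    tendsto_one_div_add_atTop_nhds_zero_nat.comp hk_top, ?_⟩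
  filter_upwards [eventually_ge_atTop (N 0)] with p hp
  exact hN _ _ (Nat.findGreatest_spec (P := fun k => N k ≤ p) (Nat.zero_le p) hp)

lemma isMultiLog_exp_mul_log {κ : ℕ → ℝ} (hpos : ∀ p, 0 < κ p) (hκ : Tendsto κ atTop (𝓝 0)) :
    IsMultiLog fun p => Real.exp (κ p * Real.log p) := by
  refine ⟨fun p => Real.exp_pos _, fun c hc => ⟨?_, ?_⟩⟩
  · refine tendsto_atTop_mono' _ ?_ ((tendsto_rpow_atTop hc).comp tendsto_natCast_atTop_atTop)
    filter_upwards with p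
    apply le_mul_of_one_le_left (Real.rpow_nonneg (Nat.cast_nonneg p) _)
    exact Real.one_le_exp (mul_nonneg (hpos p).le (Real.log_natCast_nonneg p))
  · refine squeeze_zero' (Eventually.of_forall fun p =>
      mul_nonneg (Real.exp_pos _).le (Real.rpow_nonneg (Nat.cast_nonneg p) _)) ?_
      ((tendsto_rpow_neg_atTop (half_pos hc)).comp tendsto_natCast_atTop_atTop)
    filter_upwards [hκ.eventually_le_const (half_pos hc), eventually_gt_atTop 0] with p h1 h2
    have h3 : (0 : ℝ) < p := by exact_mod_cast h2
    simp only [Function.comp]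
    rw [Real.rpow_def_of_pos h3, Real.rpow_def_of_pos h3, ← Real.exp_add]
    apply Real.exp_le_exp.2
    nlinarith [Real.log_natCast_nonneg p]

/-! ### Comparison of the sure-screening model sizes -/

section Comparison

variable {n p : ℕ} {X : Matrix (Fin n) (Fin p) ℝ} {β : Fin p → ℝ} {σ : ℝ}

lemma expMissed_anti_score {T T' : EuclideanSpace ℝ (Fin n) → Fin p → ℝ}
    (h : ∀ y j, T y j ≤ T' y j) (q : ℝ) : expMissed X β σ T' q ≤ expMissed X β σ T q := by
  refine lintegral_mono fun z => ?_
  rw [Nat.cast_le]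
  apply Finset.card_le_card
  apply Finset.sdiff_subset_sdiff le_rfl
  intro j hj
  simp only [retained, Finset.mem_filter, Finset.mem_univ, true_and] at hj ⊢
  exact hj.trans_le (h _ _)

lemma expFalse_antitone (hp : 0 ≤ Real.log p) (T : EuclideanSpace ℝ (Fin n) → Fin p → ℝ) :
    Antitone (expFalse X β σ T) := by
  intro q q' hqq
  refine lintegral_mono fun z => ?_
  rw [Nat.cast_le]
  apply Finset.card_le_card
  apply Finset.sdiff_subset_sdiff _ le_rfl
  intro j hj
  simp only [retained, Finset.mem_filter, Finset.mem_univ, true_and] at hj ⊢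
  exact lt_of_le_of_lt (mul_le_mul_of_nonneg_right (by gcongr) hp) hj

/-- At fixed `p` the exceedance events decrease to the empty set as the threshold grows, so
continuity from above applies. -/
lemma tendsto_expFalse_faCarScore (hp : 0 < Real.log p) (hσ : 0 < σ) (D : SVD X) (m : ℕ) (δ : ℝ) :
    Tendsto (fun k : ℕ => expFalse X β σ (faCarScore D m δ) k) atTop (𝓝 0) := by
  have hmeas : ∀ (k : ℕ) (j : Fin p), MeasurableSet
      {z | 2 * k * σ ^ 2 * Real.log p < faCarScore D m δ (response X β z) j} := fun k j =>
    measurableSet_lt_faCarScore D m δ β j (by positivity)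
  simp only [fun k : ℕ => expFalse_eq_sum β σ (faCarScore D m δ) k (hmeas k)]
  rw [← Finset.sum_const_zero (s := (supp β)ᶜ) (M := ℝ≥0∞)]
  refine tendsto_finsetSum _ fun j _ => ?_
  have h := tendsto_measure_iInter_atTop (μ := noiseLaw n σ)
    (s := fun k : ℕ => {z | 2 * k * σ ^ 2 * Real.log p < faCarScore D m δ (response X β z) j})
    (fun k => (hmeas k j).nullMeasurableSet)
    (fun k k' hkk z hz => lt_of_le_of_lt (mul_le_mul_of_nonneg_right
      (mul_le_mul_of_nonneg_right (mul_le_mul_of_nonneg_left (Nat.cast_le.2 hkk) zero_le_two)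
        (sq_nonneg σ)) hp.le) hz) ⟨0, measure_ne_top _ _⟩
  have hempty : ⋂ k : ℕ, {z | 2 * k * σ ^ 2 * Real.log p <
      faCarScore D m δ (response X β z) j} = ∅ := by
    ext z
    simp only [Set.mem_iInter, Set.mem_ofPred_eq, Set.mem_empty_iff_false, iff_false, not_forall,
      not_lt]
    have hc : 0 < 2 * σ ^ 2 * Real.log p := by positivity
    obtain ⟨k, hk⟩ := exists_nat_ge (faCarScore D m δ (response X β z) j / (2 * σ ^ 2 * Real.log p))
    refine ⟨k, ?_⟩
    rw [div_le_iff₀ hc] at hk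
    linarith
  rwa [hempty, measure_empty] at h

/-- If arbitrarily large thresholds are admissible, no false positives are counted. -/
lemma iInf_expFalse_faCarScore_eq_zero (hp : 0 < Real.log p) (hσ : 0 < σ) (D : SVD X) (m : ℕ)
    (δ : ℝ) {Q : Set ℝ} (hQ : ¬ BddAbove Q) :
    ⨅ q ∈ Q, expFalse X β σ (faCarScore D m δ) q = 0 := by
  rw [← nonpos_iff_eq_zero]
  refine ge_of_tendsto' (tendsto_expFalse_faCarScore (β := β) hp hσ D m δ) fun k => ?_
  obtain ⟨q, hq, hkq⟩ := not_bddAbove_iff.1 hQ k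
  exact (iInf₂_le q hq).trans (expFalse_antitone hp.le _ hkq.le)

end Comparison

/-- The factors contribute nonnegatively to the unit diagonal, so the entries of `G` are at most one
in absolute value and `|G i j| ≤ |G i j| ^ γ`. -/
lemma sum_abs_le_of_sparseCov {n p g : ℕ} {X : Matrix (Fin n) (Fin p) ℝ} {γ c₀ C₀ : ℝ}
    {κ : Type*} [Fintype κ] {lam : κ → ℝ} {v : κ → EuclideanSpace ℝ (Fin p)}
    {G : Matrix (Fin p) (Fin p) ℝ} (hγ : γ < 1) (hlam : ∀ k, 0 ≤ lam k)
    (hΘ : ∀ i j, gram X i j = ∑ k, lam k * v k i * v k j + G i j)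
    (hdiag : ∀ j, gram X j j = 1) (hG : SparseCov g γ c₀ C₀ G) (i : Fin p) :
    ∑ j, |G i j| ≤ C₀ := by
  have hd : ∀ i, G i i ≤ 1 := fun i => by
    have h := hΘ i i
    have : 0 ≤ ∑ k, lam k * v k i * v k i := Finset.sum_nonneg fun k _ => by
      rw [mul_assoc]; exact mul_nonneg (hlam k) (mul_self_nonneg _)
    rw [hdiag] at h
    linarith
  refine (Finset.sum_le_sum fun j _ => ?_).trans (hG.2.2 i)
  have h1 := abs_apply_le_one_of_posSemidef hG.1 hd i j
  rcases (abs_nonneg (G i j)).eq_or_lt with h0 | h0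
  · rw [← h0]; positivity
  · calc |G i j| = |G i j| ^ (1 : ℝ) := (Real.rpow_one _).symm
      _ ≤ _ := Real.rpow_le_rpow_of_exponent_ge h0 h1 hγ.le

/-- The quantifiers over `m`, `d`, `x`, `y` come after "eventually", because these vary with `p` and
the threshold. In the second bound half of `κ` pays for the polylogarithm and half for the bias
factor `exp y`. -/
lemma eventually_polylog_le {g : ℕ} {κ A B : ℝ} (hκ : 0 < κ) (hA : 0 ≤ A) :
    ∀ᶠ p : ℕ in atTop, ∀ (m : ℕ) (d x y : ℝ), m ≤ g → 0 ≤ d → d ≤ A * Real.log p →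
      0 ≤ x → x ≤ B * Real.log p → y ≤ κ / 2 * Real.log p →
      1 + (d + 1) ^ m ≤ Real.exp (κ * Real.log p) ∧
      ((d + 1) ^ m) ^ m * (40 * (1 + x) * Real.exp y) ≤ Real.exp (κ * Real.log p) := by
  filter_upwards [tendsto_log_natCast.eventually_ge_atTop 1,
    eventually_mul_log_pow_le (1 + (A + 1) ^ g) g hκ,
    eventually_mul_log_pow_le ((A + 1) ^ (g * g) * (40 * (1 + B))) (g * g + 1) (half_pos hκ)]
    with p hl h1 h2 m d x y hm hd0 hd hx0 hx hy
  have hl0 : 0 ≤ Real.log p := zero_le_one.trans hl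
  have hd1 : d + 1 ≤ (A + 1) * Real.log p := by nlinarith
  have hb1 : 1 ≤ (A + 1) * Real.log p := by nlinarith
  constructor
  · refine le_trans ?_ h1
    rw [add_mul, one_mul, ← mul_pow]
    apply add_le_add (one_le_pow₀ hl)
    calc (d + 1) ^ m ≤ ((A + 1) * Real.log p) ^ m := by gcongr
      _ ≤ _ := pow_le_pow_right₀ hb1 hm
  · have e1 : Real.exp (κ * Real.log p) =
        Real.exp (κ / 2 * Real.log p) * Real.exp (κ / 2 * Real.log p) := by
      rw [← Real.exp_add]; congr 1; ring
    rw [e1, ← mul_assoc, ← mul_assoc]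
    refine mul_le_mul ?_ (Real.exp_le_exp.2 hy) (Real.exp_pos _).le (Real.exp_pos _).le
    refine le_trans ?_ h2
    have h3 : ((d + 1) ^ m) ^ m ≤ ((A + 1) * Real.log p) ^ (g * g) := by
      rw [← pow_mul]
      calc (d + 1) ^ (m * m) ≤ ((A + 1) * Real.log p) ^ (m * m) := by gcongr
        _ ≤ _ := pow_le_pow_right₀ hb1 (Nat.mul_le_mul hm hm)
    have h4 : 40 * (1 + x) ≤ 40 * (1 + B) * Real.log p := by linarith
    rw [mul_assoc]
    calc ((d + 1) ^ m) ^ m * (40 * (1 + x))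
        ≤ ((A + 1) * Real.log p) ^ (g * g) * (40 * (1 + B) * Real.log p) := by gcongr
      _ = _ := by rw [mul_pow, pow_succ]; ring

set_option maxHeartbeats 1000000 in
/-- Up to a factor `p ^ κ`, FA-CAR has no more false positives than FA-MR, uniformly over
bounded thresholds. -/
theorem eventually_card_add_expFalse_le
    {r γ c₀ C₀ a b C : ℝ} {g : ℕ} (hγ : γ ∈ Set.Ioo (0 : ℝ) 1)
    (hc₀ : 0 < c₀) (hC₀ : 0 < C₀) (ha : 0 < a) (hb : 0 < b) (hg : 1 ≤ g)
    {n : ℕ → ℕ} {X : ∀ p, Matrix (Fin (n p)) (Fin p) ℝ} {β : ∀ p, Fin p → ℝ}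
    {σ : ℕ → ℝ} (hσ : ∀ p, 0 < σ p)
    {K : ℕ → ℕ} {lam : ∀ p, Fin (K p) → ℝ} {v : ∀ p, Fin (K p) → EuclideanSpace ℝ (Fin p)}
    {G₀ : ∀ p, Matrix (Fin p) (Fin p) ℝ} (hn : ∀ᶠ p in atTop, 0 < n p)
    (hlam : ∀ᶠ p in atTop, ∀ k, 0 < lam p k)
    (hv : ∀ᶠ p in atTop, Orthonormal ℝ (v p))
    (hΘ : ∀ᶠ p in atTop, ∀ i j, gram (X p) i j = ∑ k, lam p k * v p k i * v p k j + G₀ p i j)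
    (hdiag : ∀ᶠ p in atTop, ∀ j, gram (X p) j j = 1)
    (hβ : ∀ᶠ p in atTop, ∀ j ∈ supp (β p), |β p j| ≤ a * signalStrength (n p) p (σ p) r)
    (hG₀ : ∀ᶠ p in atTop, SparseCov g γ c₀ C₀ (G₀ p))
    (hlam_large : ∀ M : ℝ, ∀ᶠ p : ℕ in atTop, ∀ k,
      M * max ((supp (β p)).card : ℝ) (Real.log p) ≤ lam p k)
    {m : ℕ → ℕ} {δ : ℕ → ℝ} (hm : ∀ᶠ p in atTop, m p ≤ g)
    (hδ : ∀ᶠ p : ℕ in atTop, 1.01 * (b / Real.log p) ≤ δ p ∧ δ p ≤ C * (b / Real.log p))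
    (D : ∀ p, SVD (X p)) {κ : ℝ} (hκ : 0 < κ) (B : ℝ) :
    ∀ᶠ p in atTop, ∀ q, 0 < q → q ≤ B →
      ((supp (β p)).card : ℝ≥0∞) + expFalse (X p) (β p) (σ p) (faCarScore (D p) (m p) (δ p)) q ≤
        ENNReal.ofReal (Real.exp (κ * Real.log p)) *
          ((supp (β p)).card + expFalse (X p) (β p) (σ p) (faMrScore (D p)) q) := by
  obtain ⟨hγ0, hγ1⟩ := hγ
  set B' := max B 1 with hB'
  have hB0 : 0 < B' := lt_max_of_lt_right one_pos
  set c' := √(54 * C₀ ^ 3 + 12 * C₀ ^ 2) + 2 * C₀ with hc'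
  have hc'0 : 0 < c' := by positivity
  set k0 := g * (√(2 / c₀) * (a * √(2 * r))) * √(2 * B') with hk0
  have hk00 : 0 ≤ k0 := by positivity
  -- `η` bounds the row sums of the adjusted Gram matrix over the support; this value makes `k0 * η
  -- ≤ κ / 2`.
  set η := κ / (2 * (k0 + 1)) with hη
  have hη0 : 0 < η := by positivity
  -- The summands secure, in order, `log p ≤ Λ/2`, `ε ≤ δ c₀/4`, `s ε ≤ η/2` and `g ε ≤ c₀/2`.
  set M := 2 + 4 * c' / (b * c₀) + 2 * c' / η + 2 * g * c' / c₀ with hM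
  have hM0 : 0 < M := by positivity
  have hlog := tendsto_log_natCast
  have hdelta : Tendsto (fun p : ℕ => (C * b + c' / M) / Real.log p) atTop (𝓝 0) :=
    hlog.const_div_atTop _
  have hpow : Tendsto (fun p : ℕ => C₀ * ((C * b + c' / M) / Real.log p) ^ (1 - γ)) atTop (𝓝 0) := by
    have := hdelta.rpow_const (p := 1 - γ) (Or.inr (by linarith))
    rw [Real.zero_rpow (by linarith)] at this
    simpa using this.const_mul C₀
  have hdel2 : Tendsto (fun p : ℕ => (C * b) * (c₀ / 2) / 2 / Real.log p) atTop (𝓝 0) :=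
    hlog.const_div_atTop _
  filter_upwards [hn, hlam, hv, hΘ, hdiag, hβ, hG₀, hlam_large M, hm, hδ,
    hlog.eventually_ge_atTop 1, hlog.eventually_ge_atTop (3 * C₀), eventually_ge_atTop g,
    hpow.eventually_le_const (half_pos hη0), hdel2.eventually_le_const zero_lt_one,
    eventually_polylog_le (g := g) (A := 4 * C₀ / (b * c₀) + 1) (B := √(2 * B')) hκ
      (by positivity)]
    with p hn hlam hv hΘ hdiag hβ hG hlarge hm hδ hl1 hl3 hgp hpow hdel2 hpoly q hq hqB
  have hl0 : 0 < Real.log p := one_pos.trans_le hl1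
  set s := ((supp (β p)).card : ℝ) with hs
  have hs0 : 0 ≤ s := Nat.cast_nonneg _
  set Λ := M * max s (Real.log p) with hΛ
  have hΛlog : M * Real.log p ≤ Λ := by rw [hΛ]; gcongr; exact le_max_right _ _
  have hΛs : M * s ≤ Λ := by rw [hΛ]; gcongr; exact le_max_left _ _
  have hΛ0 : 0 < Λ := (mul_pos hM0 hl0).trans_le hΛlog
  have hM2 : 2 ≤ M := by
    have h1 : 0 ≤ 4 * c' / (b * c₀) := by positivity
    have h2 : 0 ≤ 2 * c' / η := by positivity
    have h3 : 0 ≤ 2 * g * c' / c₀ := by positivity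
    linarith
  set ε := c' / Λ with hε
  have hε0 : 0 < ε := by positivity
  have hentry := abs_gram_adjMat_sub_le (D p) hn hC₀ hΛ0 hv hΘ hdiag hG.1
    (sum_abs_le_of_sparseCov hγ1 (fun k => (hlam k).le) hΘ hdiag hG) hlarge hl3
    (by linarith [mul_le_mul_of_nonneg_right hM2 hl0.le])
  have hεlog : ε * Real.log p ≤ c' / M := by
    rw [hε, div_mul_eq_mul_div, div_le_div_iff₀ hΛ0 hM0, mul_assoc]
    exact mul_le_mul_of_nonneg_left (by linarith) hc'0.le
  have hεs : s * ε ≤ c' / M := by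
    rw [hε, mul_div_assoc', mul_comm s, div_le_div_iff₀ hΛ0 hM0, mul_assoc]
    exact mul_le_mul_of_nonneg_left (by linarith) hc'0.le
  have hcM : ∀ t : ℝ, 0 < t → c' / t ≤ M → c' / M ≤ t := by
    intro t ht h
    rw [div_le_iff₀ ht] at h
    rw [div_le_iff₀ hM0]
    linarith
  have hMb : c' / M ≤ b * c₀ / 4 := by
    apply hcM _ (by positivity)
    have h1 : c' / (b * c₀ / 4) = 4 * c' / (b * c₀) := by field_simp
    have h2 : 0 ≤ 2 * c' / η := by positivity
    have h3 : 0 ≤ 2 * g * c' / c₀ := by positivity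
    linarith
  have hMη : c' / M ≤ η / 2 := by
    apply hcM _ (by positivity)
    have h1 : c' / (η / 2) = 2 * c' / η := by field_simp
    have h2 : 0 ≤ 4 * c' / (b * c₀) := by positivity
    have h3 : 0 ≤ 2 * g * c' / c₀ := by positivity
    linarith
  have hg0 : (0 : ℝ) < g := by exact_mod_cast hg
  have hMg : c' / M ≤ c₀ / (2 * g) := by
    apply hcM _ (by positivity)
    have h1 : c' / (c₀ / (2 * g)) = 2 * g * c' / c₀ := by field_simp
    have h2 : 0 ≤ 4 * c' / (b * c₀) := by positivity
    have h3 : 0 ≤ 2 * c' / η := by positivity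
    linarith
  have hεM : ε ≤ c' / M := (le_mul_of_one_le_right hε0.le hl1).trans hεlog
  have hδlow : b / Real.log p ≤ δ p := by
    have : 0 ≤ b / Real.log p := by positivity
    linarith [hδ.1]
  have hδ0 : 0 < δ p := (div_pos hb hl0).trans_le hδlow
  have hδlog : b ≤ δ p * Real.log p := (div_le_iff₀ hl0).1 hδlow
  have hδup : δ p ≤ C * b / Real.log p := by rw [mul_div_assoc]; exact hδ.2
  have hε1 : g * ε ≤ c₀ / 2 := by
    have := hεM.trans hMg
    rw [le_div_iff₀ (by positivity)] at this
    linarith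
  have hε2 : ε ≤ δ p * (c₀ / 2) / 2 := by
    have h1 : ε * Real.log p ≤ (δ p * (c₀ / 2) / 2) * Real.log p := by
      linarith [mul_le_mul_of_nonneg_left hδlog (show 0 ≤ c₀ / 4 by positivity)]
    exact le_of_mul_le_mul_right h1 hl0
  have hδ1 : δ p * (c₀ / 2) / 2 ≤ 1 := by
    refine le_trans ?_ hdel2
    calc δ p * (c₀ / 2) / 2 ≤ (C * b / Real.log p) * (c₀ / 2) / 2 := by gcongr
      _ = _ := by ring
  have hηp : s * ε + C₀ * (δ p + ε) ^ (1 - γ) ≤ η := by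
    have h1 : δ p + ε ≤ (C * b + c' / M) / Real.log p := by
      rw [add_div]
      exact add_le_add hδup ((le_div_iff₀ hl0).2 hεlog)
    have h2 : C₀ * (δ p + ε) ^ (1 - γ) ≤ η / 2 := by
      refine le_trans ?_ hpow
      have : 0 ≤ 1 - γ := by linarith
      gcongr
    linarith
  set d := ⌈C₀ / (δ p * (c₀ / 2) / 2)⌉₊ with hd
  have hdlog : (d : ℝ) ≤ (4 * C₀ / (b * c₀) + 1) * Real.log p := by
    have h1 : C₀ / (δ p * (c₀ / 2) / 2) ≤ 4 * C₀ / (b * c₀) * Real.log p := by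
      rw [div_mul_eq_mul_div, div_le_div_iff₀ (by positivity) (by positivity)]
      have := mul_le_mul_of_nonneg_left hδlog (mul_pos hC₀ hc₀).le
      linarith
    have h2 := (Nat.ceil_lt_add_one
      (show 0 ≤ C₀ / (δ p * (c₀ / 2) / 2) by positivity)).le
    rw [← hd] at h2
    linarith
  have hmain := expFalse_faCarScore_le (D := D p) (m := m p) (δ := δ p) hn hl1 (hσ p) hγ0 hγ1 hc₀
    ha.le hdiag hG hentry hg hgp hm hβ hε1 hε2 hδ0 hδ1 hηp (Nat.le_ceil _) hq
  set x := √(2 * q * Real.log p) with hx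
  have hxlog : x ≤ √(2 * B') * √(Real.log p) := by
    rw [hx, ← Real.sqrt_mul (by positivity)]
    apply Real.sqrt_le_sqrt
    have : q ≤ B' := hqB.trans (le_max_left _ _)
    gcongr
  have hsqrt : √(Real.log p) ≤ Real.log p := by
    rw [Real.sqrt_le_left hl0.le]
    exact le_self_pow₀ hl1 two_ne_zero
  -- The bias and the threshold each contribute one `√(log p)`.
  have hy : g * (√(2 / c₀) * (a * √(2 * r * Real.log p)) * η) * x ≤ κ / 2 * Real.log p := by
    have h1 : √(2 * r * Real.log p) = √(2 * r) * √(Real.log p) := Real.sqrt_mul' _ hl0.le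
    have h2 : k0 * η ≤ κ / 2 := by
      rw [hη, mul_div_assoc', div_le_div_iff₀ (by positivity) two_pos]
      linarith
    calc _ ≤ g * (√(2 / c₀) * (a * √(2 * r * Real.log p)) * η) *
            (√(2 * B') * √(Real.log p)) := by gcongr
      _ = k0 * η * (√(Real.log p) * √(Real.log p)) := by rw [h1, hk0]; ring
      _ = k0 * η * Real.log p := by rw [Real.mul_self_sqrt hl0.le]
      _ ≤ _ := by gcongr
  obtain ⟨hp1, hp2⟩ := hpoly (m p) d x _ hm (Nat.cast_nonneg _) hdlog (Real.sqrt_nonneg _)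
    (hxlog.trans (by gcongr)) hy
  calc ((supp (β p)).card : ℝ≥0∞) + expFalse (X p) (β p) (σ p) (faCarScore (D p) (m p) (δ p)) q
      ≤ ENNReal.ofReal s + (ENNReal.ofReal (s * (d + 1 : ℝ) ^ m p) +
          ENNReal.ofReal (Real.exp (κ * Real.log p)) *
            expFalse (X p) (β p) (σ p) (faMrScore (D p)) q) := by
        rw [hs, ENNReal.ofReal_natCast]
        refine add_le_add le_rfl (hmain.trans ?_)
        gcongr
    _ = ENNReal.ofReal (s * (1 + (d + 1 : ℝ) ^ m p)) +
          ENNReal.ofReal (Real.exp (κ * Real.log p)) *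
            expFalse (X p) (β p) (σ p) (faMrScore (D p)) q := by
        rw [← add_assoc, ← ENNReal.ofReal_add hs0 (by positivity)]
        congr 2; ring
    _ ≤ ENNReal.ofReal (s * Real.exp (κ * Real.log p)) +
          ENNReal.ofReal (Real.exp (κ * Real.log p)) *
            expFalse (X p) (β p) (σ p) (faMrScore (D p)) q := by gcongr
    _ = _ := by
        rw [mul_comm s, ENNReal.ofReal_mul (Real.exp_pos _).le, ← mul_add, hs,
          ENNReal.ofReal_natCast]

/-- Up to a factor `p ^ κ`, the sure-screening model size of FA-CAR is at most that of FA-MR. -/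
theorem eventually_sureScreeningSize_le
    {r γ c₀ C₀ a b C : ℝ} {g : ℕ} (hγ : γ ∈ Set.Ioo (0 : ℝ) 1)
    (hc₀ : 0 < c₀) (hC₀ : 0 < C₀) (ha : 0 < a) (hb : 0 < b) (hg : 1 ≤ g)
    {n : ℕ → ℕ} {X : ∀ p, Matrix (Fin (n p)) (Fin p) ℝ} {β : ∀ p, Fin p → ℝ}
    {σ : ℕ → ℝ} (hσ : ∀ p, 0 < σ p)
    {K : ℕ → ℕ} {lam : ∀ p, Fin (K p) → ℝ} {v : ∀ p, Fin (K p) → EuclideanSpace ℝ (Fin p)}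
    {G₀ : ∀ p, Matrix (Fin p) (Fin p) ℝ}
    (hlam : ∀ᶠ p in atTop, ∀ k, 0 < lam p k)
    (hv : ∀ᶠ p in atTop, Orthonormal ℝ (v p))
    (hΘ : ∀ᶠ p in atTop, ∀ i j, gram (X p) i j = ∑ k, lam p k * v p k i * v p k j + G₀ p i j)
    (hdiag : ∀ᶠ p in atTop, ∀ j, gram (X p) j j = 1)
    (hβ : ∀ᶠ p in atTop, ∀ j ∈ supp (β p), |β p j| ≤ a * signalStrength (n p) p (σ p) r)
    (hG₀ : ∀ᶠ p in atTop, SparseCov g γ c₀ C₀ (G₀ p))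
    (hlam_large : ∀ M : ℝ, ∀ᶠ p : ℕ in atTop, ∀ k,
      M * max ((supp (β p)).card : ℝ) (Real.log p) ≤ lam p k)
    {m : ℕ → ℕ} {δ : ℕ → ℝ} (hm : ∀ᶠ p in atTop, 1 ≤ m p ∧ m p ≤ g)
    (hδ : ∀ᶠ p : ℕ in atTop, 1.01 * (b / Real.log p) ≤ δ p ∧ δ p ≤ C * (b / Real.log p))
    (D : ∀ p, SVD (X p)) {κ : ℝ} (hκ : 0 < κ) :
    ∀ᶠ p in atTop,
      sureScreeningSize X β σ (fun p => faCarScore (D p) (m p) (δ p)) p ≤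
        ENNReal.ofReal (Real.exp (κ * Real.log p)) *
          sureScreeningSize X β σ (fun p => faMrScore (D p)) p := by
  have hn : ∀ᶠ p in atTop, 0 < n p := by
    -- With `n p = 0` the Gram matrix would vanish, against its unit diagonal.
    filter_upwards [hdiag, eventually_gt_atTop 0] with p hp hp0
    by_contra! h
    have h0 : n p = 0 := by omega
    have := hp ⟨0, hp0⟩
    simp [gram, h0] at this
  set Q : Set ℝ := {q : ℝ | 0 < q ∧
    Tendsto (fun p' => expMissed (X p') (β p') (σ p') (faMrScore (D p')) q) atTop (𝓝 0)} with hQ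
  set Q' : Set ℝ := {q : ℝ | 0 < q ∧ Tendsto (fun p' => expMissed (X p') (β p') (σ p')
    (faCarScore (D p') (m p') (δ p')) q) atTop (𝓝 0)} with hQ'
  have hsub : Q ⊆ Q' := by
    rintro q ⟨hq0, hq⟩
    refine ⟨hq0, tendsto_of_tendsto_of_tendsto_of_le_of_le' tendsto_const_nhds hq
      (Eventually.of_forall fun _ => zero_le) ?_⟩
    filter_upwards [hn, hm] with p hn hm
    exact expMissed_anti_score (fun y j => faMrScore_le_faCarScore hn hm.1 (D p) (δ p) y j) q
  have hSS : ∀ p, sureScreeningSize X β σ (fun p => faCarScore (D p) (m p) (δ p)) p ≤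
      ((supp (β p)).card : ℝ≥0∞) +
        ⨅ q ∈ Q, expFalse (X p) (β p) (σ p) (faCarScore (D p) (m p) (δ p)) q := fun p => by
    exact add_le_add le_rfl (biInf_mono hsub)
  -- `Q` does not depend on `p`, so one bound `B` serves all dimensions. The empty `Q` falls in the
  -- bounded case, where the FA-MR size is infinite.
  by_cases hbdd : BddAbove Q
  · obtain ⟨B, hB⟩ := hbdd
    filter_upwards [eventually_card_add_expFalse_le hγ hc₀ hC₀ ha hb hg hσ hn hlam hv hΘ hdiag hβ
      hG₀ hlam_large (hm.mono fun _ h => h.2) hδ D hκ B] with p hp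
    refine (hSS p).trans ?_
    have hpos : ENNReal.ofReal (Real.exp (κ * Real.log p)) ≠ 0 := by
      simpa using Real.exp_pos _
    rw [sureScreeningSize, ENNReal.add_iInf, ENNReal.add_iInf,
      ENNReal.mul_iInf_of_ne hpos ENNReal.ofReal_ne_top]
    refine iInf_mono fun q => ?_
    rw [ENNReal.add_iInf, ENNReal.add_iInf, ENNReal.mul_iInf_of_ne hpos ENNReal.ofReal_ne_top]
    exact le_iInf fun hq => (iInf_le _ hq).trans (hp q hq.1 (hB hq))
  · filter_upwards [tendsto_log_natCast.eventually_gt_atTop 0] with p hp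
    refine (hSS p).trans ?_
    rw [iInf_expFalse_faCarScore_eq_zero hp (hσ p) (D p) (m p) (δ p) hbdd, add_zero]
    have h1 : 1 ≤ ENNReal.ofReal (Real.exp (κ * Real.log p)) := by
      rw [ENNReal.one_le_ofReal]
      exact Real.one_le_exp (by positivity)
    calc ((supp (β p)).card : ℝ≥0∞) = 1 * (supp (β p)).card := (one_mul _).symm
      _ ≤ _ := mul_le_mul' h1 le_self_add

end FACAR

end

theorem mainTheorem6
    -- the fixed constants
    (ϑ r γ c₀ C₀ c₁ a b C : ℝ) (g ℓ₀ : ℕ)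
    (hϑ : ϑ ∈ Set.Ioo (0 : ℝ) 1) (hr : 0 < r) (hγ : γ ∈ Set.Ioo (0 : ℝ) 1)
    (hc₀ : 0 < c₀) (hC₀ : 0 < C₀) (hc₁ : 0 < c₁) (ha : 0 < a) (hb : 0 < b) (hC : 0 < C)
    (hℓ₀ : 1 ≤ ℓ₀) (hℓ₀g : ℓ₀ ≤ g)
    -- the sequence of models, indexed by `p`
    (n : ℕ → ℕ) (X : ∀ p, Matrix (Fin (n p)) (Fin p) ℝ) (β : ∀ p, Fin p → ℝ)
    (σ : ℕ → ℝ) (hσ : ∀ p, 0 < σ p)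
    (K : ℕ → ℕ) (lam : ∀ p, Fin (K p) → ℝ) (v : ∀ p, Fin (K p) → EuclideanSpace ℝ (Fin p))
    (G₀ : ∀ p, Matrix (Fin p) (Fin p) ℝ)
    -- the approximate factor model for the Gram matrix, which has unit diagonal
    (hlam : ∀ᶠ p in atTop, ∀ k, 0 < lam p k)
    (hv : ∀ᶠ p in atTop, Orthonormal ℝ (v p))
    (hΘ : ∀ᶠ p in atTop, ∀ i j,
      FACAR.gram (X p) i j = ∑ k, lam p k * v p k i * v p k j + G₀ p i j)
    (hK : Tendsto (fun p => (K p : ℝ) / (min (n p) p : ℕ)) atTop (𝓝 0))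
    (hdiag : ∀ᶠ p in atTop, ∀ j, FACAR.gram (X p) j j = 1)
    -- sparsity and strength of the signals
    (hn : Tendsto (fun p : ℕ => Real.log p / (n p : ℝ)) atTop (𝓝 0))
    (hs : ∀ᶠ p : ℕ in atTop, ((FACAR.supp (β p)).card : ℝ) ≤ (p : ℝ) ^ (1 - ϑ))
    (hβ : ∀ᶠ p in atTop, ∀ j ∈ FACAR.supp (β p),
      FACAR.signalStrength (n p) p (σ p) r ≤ |β p j| ∧
      |β p j| ≤ a * FACAR.signalStrength (n p) p (σ p) r)
    -- the design
    (hG₀ : ∀ᶠ p in atTop, FACAR.SparseCov g γ c₀ C₀ (G₀ p))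
    (hlam_ratio : ∀ᶠ p in atTop, ∀ k l, lam p k ≤ c₁ * lam p l)
    (hlam_large : ∀ M : ℝ, ∀ᶠ p : ℕ in atTop, ∀ k,
      M * max ((FACAR.supp (β p)).card : ℝ) (Real.log p) ≤ lam p k)
    (hcomp : ∀ᶠ p : ℕ in atTop, FACAR.ComponentsAtMost
      (FACAR.corrGraph (G₀ p) (b / Real.log p)) (FACAR.supp (β p)) ℓ₀)
    -- the tuning parameters
    (m : ℕ → ℕ) (δ : ℕ → ℝ)
    (hm : ∀ᶠ p in atTop, ℓ₀ ≤ m p ∧ m p ≤ g)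
    (hδ : ∀ᶠ p : ℕ in atTop,
      1.01 * (b / Real.log p) ≤ δ p ∧ δ p ≤ C * (b / Real.log p))
    -- the singular value decompositions used by the factor-adjusting step
    (D : ∀ p, FACAR.SVD (X p)) :
    ∃ L : ℕ → ℝ, FACAR.IsMultiLog L ∧ ∀ᶠ p in atTop,
      FACAR.sureScreeningSize X β σ (fun p => FACAR.faCarScore (D p) (m p) (δ p)) p ≤
        ENNReal.ofReal (L p) *
          FACAR.sureScreeningSize X β σ (fun p => FACAR.faMrScore (D p)) p := by
  have hmain := fun (κ : ℝ) (hκ : 0 < κ) =>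
    FACAR.eventually_sureScreeningSize_le hγ hc₀ hC₀ ha hb (hℓ₀.trans hℓ₀g) hσ hlam hv hΘ hdiag
      (hβ.mono fun p h j hj => (h j hj).2) hG₀ hlam_large
      (hm.mono fun p h => ⟨hℓ₀.trans h.1, h.2⟩) hδ D hκ
  obtain ⟨κ, hpos, hlim, hκ⟩ := FACAR.exists_tendsto_zero_of_forall_eventually hmain
  exact ⟨_, FACAR.isMultiLog_exp_mul_log hpos hlim, hκ⟩
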